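/- Let $n\ge 0$ and let $G$ be a loopless connected signed graph on the vertex set $[n+1]=\{1,\dots,n+1\}$ (multiple edges allowed): each edge is $(i,j,-)$ or $(i,j,+)$ with $i<j$. To $(i,j,\pm)$ associate the vector $e_i\pm e_j$, and let $M_G$ be the $(n+1)\times \#E(G)$ matrix with these vectors as columns. For $a\in\mathbb Z^{n+1}$ the flow polytope is $\mathcal F_G(a)=\{f\in\mathbb R_{\ge 0}^{E(G)} : M_Gf=a\}$. Let $\mathrm{indeg}_G(i)$ be the number of negative edges $(\cdot,i,-)$, and put $d_i=\mathrm{indeg}_G(i)-1$ for $2\le i\le n+1$. Assume that $\mathrm{indeg}_G(i)\ge 1$ for all $2\le i\le n+1$ and that $\#E(G)\ge n+1$. An integer dynamic $a$-flow on $G$ assigns to each negative edge $e$ an integer $b(e)\ge 0$ and to each positive edge $e=(i,j,+)$ an integer $b_\ell(e)\ge 0$ (on a left half-edge at $i$) together with integers $b_{r,0}(e),b_{r,1}(e),\dots,b_{r,b_\ell(e)}(e)\ge 0$ (on the original right half-edge at $j$ and on $b_\ell(e)$ extra right half-edges at $j$), such that for every vertex $v$ $$\sum_{e=(\cdot,v,-)}b(e)+a_v=\sum_{e=(v,\cdot,-)}b(e)+\sum_{e=(v,\cdot,+)}b_\ell(e)+\sum_{e=(\cdot,v,+)}\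 \sum_{k=0}^{b_\ell(e)}b_{r,k}(e).$$ Let $K_G^{\mathrm{dyn}}(a)$ be the number of integer dynamic $a$-flows on $G$. Then $$\mathrm{vol}\,\mathcal F_G(2,0,\dots,0)=K_G^{\mathrm{dyn}}(0,d_2,\dots,d_n,d_{n+1}).$$ Here $\mathrm{vol}$ is the normalized volume with respect to the lattice $\ker M_G\cap\mathbb Z^{E(G)}$: with $d=\dim\ker M_G$, it is $d!$ times Lebesgue measure on translates of $\ker M_G$, scaled so that a fundamental parallelepiped of that lattice has measure $1$ (it is $0$ if $\mathcal F_G(2,0,\dots,0)$ is empty or has dimension less than $d$). Moreover, if $\mathcal F_G(2,0,\dots,0)$ has dimension $\#E(G)-(n+1)$, the same equality holds with the normalized volume taken intrinsically, with respect to the lattice of integer points parallel to the polytope's own affine span. -/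

import Mathlib

open scoped ENNReal Nat Matrix

noncomputable section

/-- A signed multigraph on the vertices `Fin (n + 1)` (the vertices `1, …, n + 1` shifted by one),
with edges labelled by `E`. The edge `e` is `(src e, tgt e, sign e)`, where `src e ≤ tgt e`
and `sign e` is `1` or `-1`. Multiple edges are allowed, and so are loops,
which are always positive. -/
structure SignedGraph (n : ℕ) (E : Type*) where
  src : E → Fin (n + 1)
  tgt : E → Fin (n + 1)
  sign : E → ℤˣ
  src_le_tgt : ∀ e, src e ≤ tgt e
  sign_of_loop : ∀ e, src e = tgt e → sign e = 1

namespace SignedGraph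

variable {n : ℕ} {E : Type*}

/-- No edge is a loop. -/
def Loopless (G : SignedGraph n E) : Prop :=
  ∀ e, G.src e ≠ G.tgt e

/-- The underlying graph (signs forgotten) is connected. -/
def Connected (G : SignedGraph n E) : Prop :=
  (SimpleGraph.fromRel fun i j => ∃ e, G.src e = i ∧ G.tgt e = j).Connected

/-- The indegree of `v`: the number of negative edges `(·, v, -)`. -/
def indeg (G : SignedGraph n E) (v : Fin (n + 1)) : ℕ :=
  Nat.card {e : E // G.sign e = -1 ∧ G.tgt e = v}

/-- The positive root of an edge: `(i, j, -)` gives `e_i - e_j`, `(i, j, +)` gives `e_i + e_j`;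
in particular a loop `(i, i, +)` gives `2 e_i`. -/
def root (G : SignedGraph n E) (e : E) : Fin (n + 1) → ℤ :=
  Pi.single (G.src e) 1 + (G.sign e : ℤ) • Pi.single (G.tgt e) 1

/-- The real matrix whose columns are the roots of the edges. -/
def rootMatrix (G : SignedGraph n E) : Matrix (Fin (n + 1)) E ℝ :=
  Matrix.of fun v e => (G.root e v : ℝ)

/-- The flow polytope of `G` with netflow `a`: all nonnegative real vectors `f`, indexed by the
edges, with `M_G f = a`. -/
def flowPolytope [Fintype E] (G : SignedGraph n E) (a : Fin (n + 1) → ℤ) : Set (E → ℝ) :=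
  {f | (∀ e, 0 ≤ f e) ∧ G.rootMatrix *ᵥ f = fun v => (a v : ℝ)}

/-- The space of real flows with netflow zero, that is, the kernel of `M_G`. Every flow polytope
of `G` lies in a translate of it. -/
def flowSpace [Fintype E] (G : SignedGraph n E) : Submodule ℝ (E → ℝ) :=
  LinearMap.ker G.rootMatrix.mulVecLin

/-- An integer dynamic flow on `G` with netflow `a`. A positive edge `(i, j, +)` is split into a
left half at `i` and a right half at `j`; when the left half carries `left e` units of flow,
`left e` extra right half-edges appear at `j`, and each of them also carries a flow. -/
structure DynamicFlow [Fintype E] (G : SignedGraph n E) (a : Fin (n + 1) → ℤ) where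
  /-- flow on the negative edges -/
  flow : {e : E // G.sign e = -1} → ℕ
  /-- flow on the left half of a positive edge -/
  left : {e : E // G.sign e = 1} → ℕ
  /-- flow on the original right half of a positive edge -/
  right : {e : E // G.sign e = 1} → ℕ
  /-- flow on the extra right half-edges that a positive edge creates -/
  extra : (e : {e : E // G.sign e = 1}) → Fin (left e) → ℕ
  /-- incoming flow plus netflow equals outgoing flow at every vertex -/
  conservation : ∀ v : Fin (n + 1),
    ((∑ e : {e : E // G.sign e = -1}, if G.tgt e = v then flow e else 0 : ℕ) : ℤ) + a v =
      ((∑ e : {e : E // G.sign e = -1}, if G.src e = v then flow e else 0 : ℕ) : ℤ)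
      + ((∑ e : {e : E // G.sign e = 1}, if G.src e = v then left e else 0 : ℕ) : ℤ)
      + ((∑ e : {e : E // G.sign e = 1}, if G.tgt e = v then right e else 0 : ℕ) : ℤ)
      + ((∑ e : {e : E // G.sign e = 1},
          if G.tgt e = v then ∑ k : Fin (left e), extra e k else 0 : ℕ) : ℤ)

/-- The dynamic Kostant partition function: the number of integer dynamic flows with
netflow `a`. -/
def dynamicKostant [Fintype E] (G : SignedGraph n E) (a : Fin (n + 1) → ℤ) : ℕ∞ :=
  ENat.card (G.DynamicFlow a)

/-- The netflow vector `(0, d_2, …, d_{n+1})` with `d_i = indeg i - 1`. -/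
def shiftedIndeg (G : SignedGraph n E) : Fin (n + 1) → ℤ :=
  fun i => if i = 0 then 0 else (G.indeg i : ℤ) - 1

end SignedGraph

section NormalizedVolume

variable {ι : Type*}

/-- The inclusion of the integer points into real space. -/
def intVec : (ι → ℤ) →ₗ[ℤ] (ι → ℝ) :=
  (Int.castAddHom ℝ).toIntLinearMap.compLeft ι

/-- The lattice of integer points of a linear subspace. -/
def integerPoints (V : Submodule ℝ (ι → ℝ)) : Submodule ℤ (ι → ℤ) :=
  (V.restrictScalars ℤ).comap intVec

/-- The normalized volume of a set `P` lying in a translate of a rational subspace `V`: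
with `d = dim V`, it is `d!` times the Lebesgue measure of `P` in the coordinates given by a
`ℤ`-basis of the lattice of integer points of `V`, so that a unimodular `d`-simplex has volume `1`.
It depends neither on the lattice basis nor on the base point in `P`.
It is `0` if `P` spans less than a translate of `V`. -/
def normalizedVolumeIn [Fintype ι] (V : Submodule ℝ (ι → ℝ)) (P : Set (ι → ℝ)) : ℝ≥0∞ :=
  open Classical in
  if h : P.Nonempty then
    ((Module.finrank ℤ (integerPoints V))! : ℝ≥0∞) *
      MeasureTheory.volume {y : Fin (Module.finrank ℤ (integerPoints V)) → ℝ |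
        h.some + ∑ k, y k • intVec (Module.finBasis ℤ (integerPoints V) k : ι → ℤ) ∈ P}
  else 0

/-- The normalized volume of a polytope with respect to the lattice of its own affine span. -/
def normalizedVolume [Fintype ι] (P : Set (ι → ℝ)) : ℝ≥0∞ :=
  normalizedVolumeIn (vectorSpan ℝ P) P

end NormalizedVolume

end

/-!
Scale the flow polytope to a cone: its points are the nonnegative flows that are conserved at every
vertex but the first, and the height is the total flow on the positive edges. Integrating
`exp (-height)` over the slices shows that the normalized volume is the integral of `exp (-height)`
over the cone, in lattice coordinates.

Choosing one incoming negative edge at every vertex but the first, one can take the flow on all the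
other edges as lattice coordinates. Take the vertices in increasing order. Integrating over the
flow on the edges that enter a vertex, for a fixed outgoing flow, is a Dirichlet integral over a
simplex, and gives a divided power of the outgoing flow. Its multinomial expansion distributes the
exponent over the outgoing half-edges, exactly as an integer flow with netflow `indeg - 1` does. In
the end a product of two divided powers of exponents `l` and `r` is left on every positive edge; its
exponential integral is `(l + r).choose l`, the number of ways to distribute the flow `r` on the
right half over the `l + 1` right half-edges of a dynamic flow.
-/

noncomputable section

open MeasureTheory

section PowDensity

variable {ι : Type*}

/-- The density `x ^ b / b!` on the nonnegative reals, extended by zero. The family is closed under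
convolution, and, up to integer factors, under products. -/
def powDensity (b : ℕ) (x : ℝ) : ℝ≥0∞ :=
  if 0 ≤ x then ENNReal.ofReal (x ^ b / b !) else 0

lemma powDensity_of_nonneg (b : ℕ) {x : ℝ} (hx : 0 ≤ x) :
    powDensity b x = ENNReal.ofReal (x ^ b / b !) := if_pos hx

lemma powDensity_of_neg (b : ℕ) {x : ℝ} (hx : x < 0) : powDensity b x = 0 := if_neg (not_le.2 hx)

lemma powDensity_zero (x : ℝ) : powDensity 0 x = if 0 ≤ x then 1 else 0 := by
  simp [powDensity]

@[fun_prop]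
lemma measurable_powDensity (b : ℕ) : Measurable (powDensity b) :=
  Measurable.ite measurableSet_Ici (by fun_prop) measurable_const

lemma lintegral_powDensity_mul_zero (b : ℕ) (x : ℝ) :
    ∫⁻ y, powDensity b y * powDensity 0 (x - y) = powDensity (b + 1) x := by
  have indicator_eq : ∀ y, powDensity b y * powDensity 0 (x - y) =
      (Set.Icc 0 x).indicator (fun y => ENNReal.ofReal (y ^ b / b !)) y := by
    intro y
    by_cases h0 : 0 ≤ y <;> by_cases h2 : y ≤ x <;>
      simp [powDensity, Set.indicator, h0, h2]
  simp_rw [indicator_eq]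
  rw [lintegral_indicator measurableSet_Icc]
  rcases le_or_gt 0 x with hx | hx
  · rw [powDensity_of_nonneg _ hx, ← ofReal_integral_eq_lintegral_ofReal
        (Continuous.integrableOn_Icc (by fun_prop))
        ((ae_restrict_iff' measurableSet_Icc).2 (.of_forall fun y hy =>
          div_nonneg (pow_nonneg hy.1 b) (Nat.cast_nonneg _))),
      integral_Icc_eq_integral_Ioc, ← intervalIntegral.integral_of_le hx,
      intervalIntegral.integral_div, integral_pow, Nat.factorial_succ]
    congr 1
    push_cast
    field_simp
    simp
  · rw [Set.Icc_eq_empty (not_le.2 hx), powDensity_of_neg _ hx]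
    simp

open scoped MeasureTheory in
lemma powDensity_lconvolution (a b : ℕ) :
    powDensity a ⋆ₗ[volume] powDensity b = powDensity (a + b + 1) := by
  have convolution_zero : ∀ a, powDensity a ⋆ₗ[volume] powDensity 0 = powDensity (a + 1) := by
    intro a
    funext x
    simp_rw [lconvolution_def, ← lintegral_powDensity_mul_zero, neg_add_eq_sub]
  induction b with
  | zero => exact convolution_zero a
  | succ b ih =>
    rw [← convolution_zero b, lconvolution_assoc (by fun_prop) (by fun_prop) (by fun_prop), ih,
      convolution_zero, add_assoc a b 1]

lemma lintegral_powDensity_mul (a b : ℕ) (x : ℝ) :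
    ∫⁻ y, powDensity a y * powDensity b (x - y) = powDensity (a + b + 1) x := by
  simp_rw [← powDensity_lconvolution, lconvolution_def, neg_add_eq_sub]

lemma lmarginal_prod_powDensity [DecidableEq ι] (s : Finset ι) (b : ι → ℕ) (c : ℕ)
    (x : ℝ) (y₀ : ι → ℝ) :
    lmarginal (fun _ : ι => (volume : Measure ℝ)) s
      (fun y => (∏ i ∈ s, powDensity (b i) (y i)) * powDensity c (x - ∑ i ∈ s, y i)) y₀ =
      powDensity (c + ∑ i ∈ s, (b i + 1)) x := by
  induction s using Finset.induction_on generalizing c with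
  | empty => simp
  | insert i s hi ih =>
    rw [lmarginal_insert' _ (by fun_prop) hi, Finset.sum_insert hi,
      show c + (b i + 1 + ∑ i ∈ s, (b i + 1)) = (b i + c + 1) + ∑ i ∈ s, (b i + 1) by ring, ← ih]
    congr 1
    funext y
    rw [← lintegral_powDensity_mul, ← lintegral_const_mul _ (by fun_prop)]
    refine lintegral_congr fun z => ?_
    have update_eq : ∀ j ∈ s, Function.update y i z j = y j := fun j hj =>
      Function.update_of_ne (ne_of_mem_of_not_mem hj hi) _ _
    rw [Finset.prod_insert hi, Finset.sum_insert hi, Function.update_self,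
      Finset.sum_congr rfl update_eq, Finset.prod_congr rfl fun j hj => by rw [update_eq j hj],
      ← sub_sub, sub_right_comm]
    ring

lemma pow_sum_div_factorial {K : Type*} [Field K] [CharZero K] [DecidableEq ι] (s : Finset ι)
    (c : ℕ) (x : ι → K) :
    (∑ i ∈ s, x i) ^ c / c ! = ∑ b ∈ s.piAntidiag c, ∏ i ∈ s, x i ^ b i / (b i)! := by
  rw [Finset.sum_pow_eq_sum_piAntidiag, Finset.sum_div]
  refine Finset.sum_congr rfl fun b hb => ?_
  have spec : (∏ i ∈ s, ((b i)! : K)) * Nat.multinomial s b = c ! := by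
    rw [← (Finset.mem_piAntidiag.1 hb).1]
    exact_mod_cast Nat.multinomial_spec s b
  have factorial_ne : (c ! : K) ≠ 0 := Nat.cast_ne_zero.2 c.factorial_ne_zero
  have prod_ne : ∏ i ∈ s, ((b i)! : K) ≠ 0 := left_ne_zero_of_mul (spec ▸ factorial_ne)
  rw [Finset.prod_div_distrib, div_eq_div_iff factorial_ne prod_ne, ← spec]
  ring

lemma prod_powDensity_of_nonneg {s : Finset ι} {x : ι → ℝ} (hx : ∀ i ∈ s, 0 ≤ x i) (b : ι → ℕ) :
    ∏ i ∈ s, powDensity (b i) (x i) = ENNReal.ofReal (∏ i ∈ s, x i ^ b i / (b i)!) := by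
  rw [ENNReal.ofReal_prod_of_nonneg fun i hi =>
    div_nonneg (pow_nonneg (hx i hi) _) (Nat.cast_nonneg _)]
  exact Finset.prod_congr rfl fun i hi => powDensity_of_nonneg _ (hx i hi)

lemma powDensity_sum [DecidableEq ι] (s : Finset ι) (c : ℕ) (x : ι → ℝ) :
    powDensity c (∑ i ∈ s, x i) * ∏ i ∈ s, powDensity 0 (x i) =
      ∑ b ∈ s.piAntidiag c, ∏ i ∈ s, powDensity (b i) (x i) := by
  by_cases hx : ∀ i ∈ s, 0 ≤ x i
  · have monomial_nonneg : ∀ b : ι → ℕ, 0 ≤ ∏ i ∈ s, x i ^ b i / (b i)! := fun b =>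
      Finset.prod_nonneg fun i hi => div_nonneg (pow_nonneg (hx i hi) _) (Nat.cast_nonneg _)
    rw [Finset.prod_eq_one fun i hi => by rw [powDensity_zero, if_pos (hx i hi)], mul_one,
      powDensity_of_nonneg _ (Finset.sum_nonneg hx), pow_sum_div_factorial,
      ENNReal.ofReal_sum_of_nonneg fun b _ => monomial_nonneg b]
    exact Finset.sum_congr rfl fun b _ => (prod_powDensity_of_nonneg hx b).symm
  · push Not at hx
    obtain ⟨i, hi, hxi⟩ := hx
    rw [Finset.prod_eq_zero hi (powDensity_of_neg _ hxi), mul_zero]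
    exact (Finset.sum_eq_zero fun b _ => Finset.prod_eq_zero hi (powDensity_of_neg _ hxi)).symm

lemma prod_powDensity_const {s : Finset ι} (hs : s.Nonempty) (b : ι → ℕ) (x : ℝ) :
    ∏ i ∈ s, powDensity (b i) x = Nat.multinomial s b * powDensity (∑ i ∈ s, b i) x := by
  rcases le_or_gt 0 x with hx | hx
  · rw [prod_powDensity_of_nonneg (fun _ _ => hx), powDensity_of_nonneg _ hx,
      ← ENNReal.ofReal_natCast, ← ENNReal.ofReal_mul (Nat.cast_nonneg _),
      Finset.prod_div_distrib, Finset.prod_pow_eq_pow_sum]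
    congr 1
    have spec : (∏ i ∈ s, ((b i)! : ℝ)) * Nat.multinomial s b = (∑ i ∈ s, b i)! :=
      mod_cast Nat.multinomial_spec s b
    have prod_ne : ∏ i ∈ s, ((b i)! : ℝ) ≠ 0 := Finset.prod_ne_zero_iff.2 fun i _ => by positivity
    have multinomial_ne : (Nat.multinomial s b : ℝ) ≠ 0 :=
      Nat.cast_ne_zero.2 (Nat.multinomial_pos s b).ne'
    rw [← spec]
    field_simp
  · obtain ⟨i, hi⟩ := hs
    rw [powDensity_of_neg _ hx, mul_zero, Finset.prod_eq_zero hi (powDensity_of_neg _ hx)]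

lemma lintegral_exp_mul_powDensity (a : ℕ) :
    ∫⁻ x, ENNReal.ofReal (Real.exp (-x)) * powDensity a x = 1 := by
  rw [← ProbabilityTheory.lintegral_gammaPDF_eq_one (a := a + 1) (r := 1) (by positivity) one_pos]
  refine lintegral_congr fun x => ?_
  rcases le_or_gt 0 x with hx | hx
  · rw [powDensity_of_nonneg _ hx, ProbabilityTheory.gammaPDF_of_nonneg hx,
      ← ENNReal.ofReal_mul (Real.exp_nonneg _), Real.Gamma_nat_eq_factorial, add_sub_cancel_right,
      Real.rpow_natCast, Real.one_rpow]
    ring_nf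
  · rw [powDensity_of_neg _ hx, ProbabilityTheory.gammaPDF_of_neg hx, mul_zero]

lemma lintegral_exp_mul_prod_powDensity {s : Finset ι} (hs : s.Nonempty) (b : ι → ℕ) :
    ∫⁻ x, ENNReal.ofReal (Real.exp (-x)) * ∏ i ∈ s, powDensity (b i) x = Nat.multinomial s b := by
  simp_rw [prod_powDensity_const hs, mul_left_comm _ (Nat.multinomial s b : ℝ≥0∞)]
  rw [lintegral_const_mul _ (by fun_prop), lintegral_exp_mul_powDensity, mul_one]

lemma lmarginal_prod [DecidableEq ι] {X : ι → Type*} [∀ i, MeasurableSpace (X i)]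
    (μ : ∀ i, Measure (X i)) [∀ i, SigmaFinite (μ i)] (s : Finset ι) {g : ∀ i, X i → ℝ≥0∞}
    (hg : ∀ i, Measurable (g i)) (y₀ : ∀ i, X i) :
    lmarginal μ s (fun y => ∏ i ∈ s, g i (y i)) y₀ = ∏ i ∈ s, ∫⁻ x, g i x ∂μ i := by
  induction s using Finset.induction_on generalizing y₀ with
  | empty => simp
  | insert i s hi ih =>
    have integral_split : ∀ y : ∀ i, X i,
        ∫⁻ x, ∏ j ∈ insert i s, g j (Function.update y i x j) ∂μ i =
          (∫⁻ x, g i x ∂μ i) * ∏ j ∈ s, g j (y j) := by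
      intro y
      rw [← lintegral_mul_const _ (hg i)]
      refine lintegral_congr fun x => ?_
      rw [Finset.prod_insert hi, Function.update_self, Finset.prod_congr rfl fun j hj => by
        rw [Function.update_of_ne (ne_of_mem_of_not_mem hj hi)]]
    have measurable_prod : ∀ t : Finset ι, Measurable fun y : ∀ i, X i => ∏ j ∈ t, g j (y j) :=
      fun t => Finset.measurable_prod t fun j _ => (hg j).comp (measurable_pi_apply j)
    rw [lmarginal_insert' _ (measurable_prod _) hi, Finset.prod_insert hi, ← ih y₀]
    simp_rw [integral_split, lmarginal]
    exact lintegral_const_mul _ ((measurable_prod s).comp measurable_updateFinset)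

end PowDensity

section LatticeBasis

variable {ι κ κ' : Type*} [Fintype κ] [Fintype κ']

@[simp] lemma intVec_apply (u : ι → ℤ) (i : ι) : intVec u i = (u i : ℝ) := rfl

variable {Λ : Submodule ℤ (ι → ℤ)}

/-- The real vector with coordinates `y` in a basis of a lattice of integer vectors. -/
def realCombination (b : Module.Basis κ ℤ Λ) : (κ → ℝ) →ₗ[ℝ] ι → ℝ :=
  Fintype.linearCombination ℝ fun k => intVec (b k : ι → ℤ)

lemma realCombination_apply (b : Module.Basis κ ℤ Λ) (y : κ → ℝ) :
    realCombination b y = ∑ k, y k • intVec (b k : ι → ℤ) := rfl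

@[fun_prop]
lemma measurable_realCombination (b : Module.Basis κ ℤ Λ) : Measurable (realCombination b) :=
  measurable_pi_lambda _ fun i => by
    simp only [realCombination_apply, Finset.sum_apply, Pi.smul_apply]
    fun_prop

lemma realCombination_reindex (b : Module.Basis κ ℤ Λ) (σ : κ ≃ κ') (y : κ' → ℝ) :
    realCombination (b.reindex σ) y = realCombination b (y ∘ σ) := by
  simp only [realCombination_apply, Module.Basis.reindex_apply, Function.comp_apply]
  exact (Fintype.sum_equiv σ _ _ fun k => by rw [σ.symm_apply_apply]).symm

lemma realCombination_toMatrix_mulVec (b : Module.Basis κ ℤ Λ) (b' : Module.Basis κ' ℤ Λ)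
    (y : κ → ℝ) :
    realCombination b' ((b'.toMatrix b).map (Int.castRingHom ℝ) *ᵥ y) = realCombination b y := by
  have intVec_basis : ∀ k,
      intVec (b k : ι → ℤ) = ∑ j, (b'.toMatrix b j k : ℝ) • intVec (b' j : ι → ℤ) := by
    intro k
    rw [← b'.sum_toMatrix_smul_self b k, Submodule.coe_sum, map_sum]
    refine Finset.sum_congr rfl fun j _ => ?_
    rw [Submodule.coe_smul, map_smul, Int.cast_smul_eq_zsmul]
  simp only [realCombination_apply, intVec_basis, Matrix.mulVec, dotProduct, Finset.smul_sum,
    Finset.sum_smul, smul_smul]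
  rw [Finset.sum_comm]
  simp only [Matrix.map_apply, Int.coe_castRingHom, mul_comm]

lemma abs_det_toMatrix_map [DecidableEq κ] (b b' : Module.Basis κ ℤ Λ) :
    |((b'.toMatrix b).map (Int.castRingHom ℝ)).det| = 1 := by
  have det_isUnit : IsUnit (b'.toMatrix b).det :=
    Matrix.isUnit_det_of_right_inverse (b'.toMatrix_mul_toMatrix_flip b)
  rw [← RingHom.mapMatrix_apply, ← RingHom.map_det, Int.coe_castRingHom, ← Int.cast_abs,
    Int.isUnit_iff_abs_eq.1 det_isUnit, Int.cast_one]

lemma measurePreserving_mulVec {κ : Type*} [Fintype κ] [DecidableEq κ] {M : Matrix κ κ ℝ}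
    (hM : |M.det| = 1) : MeasurePreserving fun y => M *ᵥ y := by
  have det_ne : M.det ≠ 0 := abs_pos.1 (hM ▸ one_pos)
  refine ⟨(Matrix.mulVecLin M).continuous_of_finiteDimensional.measurable, ?_⟩
  have map_volume := Real.map_matrix_volume_pi_eq_smul_volume_pi det_ne
  rw [abs_inv, hM, inv_one, ENNReal.ofReal_one, one_smul] at map_volume
  exact map_volume

lemma volume_preserving_comp_equiv (σ : κ' ≃ κ) : MeasurePreserving fun y : κ → ℝ => y ∘ σ := by
  have coe_piCongrLeft : ⇑(MeasurableEquiv.piCongrLeft (fun _ : κ' => ℝ) σ.symm) = (· ∘ σ) := by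
    ext y i
    exact (congrArg _ (σ.symm_apply_apply i)).symm.trans
      (Equiv.piCongrLeft_apply_apply (P := fun _ => ℝ) σ.symm y (σ i))
  exact coe_piCongrLeft ▸ volume_measurePreserving_piCongrLeft (fun _ : κ' => ℝ) σ.symm

/-- Two bases of a lattice differ by a unimodular matrix, so they induce the same measure. -/
lemma lintegral_realCombination_eq (b : Module.Basis κ ℤ Λ) (b' : Module.Basis κ' ℤ Λ)
    {F : (ι → ℝ) → ℝ≥0∞} (hF : Measurable F) :
    ∫⁻ y, F (realCombination b y) = ∫⁻ y, F (realCombination b' y) := by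
  classical
  let σ : κ' ≃ κ := b'.indexEquiv b
  calc ∫⁻ y, F (realCombination b y)
      = ∫⁻ y, F (realCombination (b'.reindex σ)
          (((b'.reindex σ).toMatrix b).map (Int.castRingHom ℝ) *ᵥ y)) := by
        simp only [realCombination_toMatrix_mulVec]
    _ = ∫⁻ y, F (realCombination (b'.reindex σ) y) :=
        (measurePreserving_mulVec (abs_det_toMatrix_map b (b'.reindex σ))).lintegral_comp
          (f := fun y => F (realCombination (b'.reindex σ) y)) (by fun_prop)
    _ = ∫⁻ y, F (realCombination b' (y ∘ σ)) := by simp only [realCombination_reindex]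
    _ = ∫⁻ y, F (realCombination b' y) :=
        (volume_preserving_comp_equiv σ).lintegral_comp
          (f := fun y => F (realCombination b' y)) (by fun_prop)

end LatticeBasis

section Cone

open scoped Pointwise

variable {d : ℕ} {C : Set (Fin (d + 1) → ℝ)}

lemma volume_preserving_cons :
    MeasurePreserving fun p : ℝ × (Fin d → ℝ) => (Fin.cons p.1 p.2 : Fin (d + 1) → ℝ) := by
  simpa [Fin.insertNthEquiv, Fin.insertNth_zero] using
    (volume_preserving_piFinSuccAbove (fun _ : Fin (d + 1) => ℝ) 0).symm

lemma volume_cone_slice (hsmul : ∀ a : ℝ, 0 < a → ∀ y ∈ C, a • y ∈ C) (hpos : ∀ y ∈ C, 0 ≤ y 0)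
    {a : ℝ} (ha : a ≠ 0) :
    volume {z : Fin d → ℝ | Fin.cons a z ∈ C} =
      powDensity d a * ((d ! : ℝ≥0∞) * volume {z : Fin d → ℝ | Fin.cons 1 z ∈ C}) := by
  rcases lt_or_gt_of_ne ha with ha | ha
  · have slice_empty : {z : Fin d → ℝ | Fin.cons a z ∈ C} = ∅ :=
      Set.eq_empty_of_forall_notMem fun z hz => (hpos _ hz).not_gt ha
    rw [powDensity_of_neg _ ha, zero_mul, slice_empty, measure_empty]
  · have smul_cons : ∀ (c x : ℝ) (z : Fin d → ℝ),
        c • (Fin.cons x z : Fin (d + 1) → ℝ) = Fin.cons (c * x) (c • z) := fun c x z => by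
      funext i
      cases i using Fin.cases <;> simp
    have slice_eq : {z : Fin d → ℝ | Fin.cons a z ∈ C} =
        a • {z : Fin d → ℝ | Fin.cons 1 z ∈ C} := by
      ext z
      rw [Set.mem_smul_set_iff_inv_smul_mem₀ ha.ne']
      constructor <;> intro hz
      · simpa [smul_cons, ha.ne'] using hsmul a⁻¹ (inv_pos.2 ha) _ hz
      · simpa [smul_cons, ha.ne'] using hsmul a ha _ hz
    rw [slice_eq, Measure.addHaar_smul, Module.finrank_fin_fun, powDensity_of_nonneg _ ha.le,
      ← mul_assoc, ← ENNReal.ofReal_natCast, ← ENNReal.ofReal_mul (by positivity),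
      div_mul_cancel₀ _ (by positivity), abs_of_pos (by positivity)]

/-- The slice of the cone at height `a` has volume proportional to `a ^ d`. -/
lemma setLIntegral_exp_cone (hC : MeasurableSet C)
    (hsmul : ∀ a : ℝ, 0 < a → ∀ y ∈ C, a • y ∈ C) (hpos : ∀ y ∈ C, 0 ≤ y 0) :
    ∫⁻ y in C, ENNReal.ofReal (Real.exp (-y 0)) =
      (d ! : ℝ≥0∞) * volume {z : Fin d → ℝ | Fin.cons 1 z ∈ C} := by
  let V := volume {z : Fin d → ℝ | Fin.cons 1 z ∈ C}
  let F : (Fin (d + 1) → ℝ) → ℝ≥0∞ := C.indicator fun y => ENNReal.ofReal (Real.exp (-y 0))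
  have hF : Measurable F := Measurable.indicator (by fun_prop) hC
  have integral_slice : ∀ a : ℝ, ∫⁻ z : Fin d → ℝ, F (Fin.cons a z) =
      ENNReal.ofReal (Real.exp (-a)) * volume {z : Fin d → ℝ | Fin.cons a z ∈ C} := by
    intro a
    have measurableSet_slice : MeasurableSet {z : Fin d → ℝ | Fin.cons a z ∈ C} :=
      hC.preimage (volume_preserving_cons.measurable.comp measurable_prodMk_left)
    rw [← lintegral_indicator_const measurableSet_slice]
    rfl
  calc ∫⁻ y in C, ENNReal.ofReal (Real.exp (-y 0))
      = ∫⁻ y, F y := (lintegral_indicator hC _).symm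
    _ = ∫⁻ p : ℝ × (Fin d → ℝ), F (Fin.cons p.1 p.2) :=
        (volume_preserving_cons.lintegral_comp hF).symm
    _ = ∫⁻ a, ∫⁻ z : Fin d → ℝ, F (Fin.cons a z) :=
        lintegral_prod _ (hF.comp volume_preserving_cons.measurable).aemeasurable
    _ = ∫⁻ a, ENNReal.ofReal (Real.exp (-a)) * powDensity d a * ((d ! : ℝ≥0∞) * V) := by
        refine lintegral_congr_ae ?_
        filter_upwards [Measure.ae_ne volume (0 : ℝ)] with a ha
        rw [integral_slice, volume_cone_slice hsmul hpos ha, mul_assoc]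
    _ = (d ! : ℝ≥0∞) * V := by
        rw [lintegral_mul_const _ (by fun_prop), lintegral_exp_mul_powDensity, one_mul]

end Cone

lemma normalizedVolumeIn_eq_of_basePoint {ι : Type*} [Fintype ι] (V : Submodule ℝ (ι → ℝ))
    {P : Set (ι → ℝ)} {p₀ : ι → ℝ}
    (hP : ∀ p ∈ P, ∃ c, p₀ + realCombination (Module.finBasis ℤ (integerPoints V)) c = p) :
    normalizedVolumeIn V P = ((Module.finrank ℤ (integerPoints V))! : ℝ≥0∞) *
      volume {y | p₀ + realCombination (Module.finBasis ℤ (integerPoints V)) y ∈ P} := by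
  rw [normalizedVolumeIn]
  split_ifs with nonempty
  · obtain ⟨c, hc⟩ := hP _ nonempty.some_mem
    rw [← measure_preimage_add volume c
      {y | p₀ + realCombination (Module.finBasis ℤ (integerPoints V)) y ∈ P}, ← hc]
    simp only [Set.preimage_ofPred_eq, map_add, ← add_assoc]
    rfl
  · have section_empty :
        {y | p₀ + realCombination (Module.finBasis ℤ (integerPoints V)) y ∈ P} = ∅ :=
      Set.eq_empty_of_forall_notMem fun y hy => nonempty ⟨_, hy⟩
    rw [section_empty, measure_empty, mul_zero]

namespace SignedGraph

variable {n : ℕ} {E : Type*}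

section HalfEdges

variable (G : SignedGraph n E)

/-- The outgoing half-edges: the left half of every edge, sitting at its source, and the right half
of every positive edge, sitting at its target. -/
abbrev HalfEdge : Type _ := E ⊕ {e : E // G.sign e = 1}

/-- The edge containing a half-edge. -/
def edge : G.HalfEdge → E := Sum.elim id Subtype.val

/-- The vertex at which a half-edge sits, as a natural number. -/
def vertex : G.HalfEdge → ℕ := Sum.elim (fun e => G.src e) fun e => G.tgt e

/-- The vertex entered by an edge, as a natural number, where the positive edges, which enter no
vertex of `G`, are directed to an additional sink `n + 1`. In this way the flow on every edge is
distributed from its half-edges towards a strictly later vertex. -/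
def head (e : E) : ℕ := if G.sign e = 1 then n + 1 else G.tgt e

variable {G}

lemma head_of_pos {e : E} (he : G.sign e = 1) : G.head e = n + 1 := if_pos he

lemma head_of_neg {e : E} (he : G.sign e = -1) : G.head e = G.tgt e :=
  if_neg (by rw [he]; decide)

lemma head_le (e : E) : G.head e ≤ n + 1 := by
  unfold head
  split_ifs <;> omega

lemma head_eq_iff {e : E} {v : Fin (n + 1)} :
    G.head e = v ↔ G.sign e = -1 ∧ G.tgt e = v := by
  rcases Int.units_eq_one_or (G.sign e) with he | he
  · have := v.2
    simp [head_of_pos he, he, show n + 1 ≠ v by omega]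
  · simp [head_of_neg he, he, Fin.val_inj]

lemma head_eq_succ_iff {e : E} : G.head e = n + 1 ↔ G.sign e = 1 := by
  unfold head
  split_ifs with he
  · simp [he]
  · simp [he, (G.tgt e).2.ne]

lemma vertex_lt (h : G.HalfEdge) : G.vertex h < n + 1 := by
  rcases h with e | e
  exacts [(G.src e).2, (G.tgt e).2]

lemma vertex_lt_head (h : G.HalfEdge) : G.vertex h < G.head (G.edge h) := by
  rcases h with e | ⟨e, he⟩
  · change (G.src e : ℕ) < G.head e
    unfold head
    split_ifs with he
    · exact (G.src e).2
    · exact lt_of_le_of_ne (G.src_le_tgt e) fun h => he (G.sign_of_loop e (Fin.ext h))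
  · exact (vertex_lt _).trans_eq (head_of_pos he).symm

lemma head_pos (e : E) : 0 < G.head e := (Nat.zero_le _).trans_lt (vertex_lt_head (.inl e))

end HalfEdges

variable [Fintype E]

section Flows

variable (G : SignedGraph n E)

/-- The edges entering the vertex `k`; for `k = n + 1` these are the positive edges. -/
def inEdges (k : ℕ) : Finset E := {e | G.head e = k}

/-- The half-edges sitting at the vertex `k`. -/
def outHalves (k : ℕ) : Finset G.HalfEdge := {h | G.vertex h = k}

variable {G}

@[simp] lemma mem_inEdges {k : ℕ} {e : E} : e ∈ G.inEdges k ↔ G.head e = k := by simp [inEdges]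

@[simp] lemma mem_outHalves {k : ℕ} {h : G.HalfEdge} : h ∈ G.outHalves k ↔ G.vertex h = k := by
  simp [outHalves]

lemma lt_head_of_mem_outHalves {k : ℕ} {h : G.HalfEdge} (hh : h ∈ G.outHalves k) :
    k < G.head (G.edge h) :=
  mem_outHalves.1 hh ▸ vertex_lt_head h

lemma vertex_inl_lt_of_mem_inEdges {k : ℕ} {e : E} (he : e ∈ G.inEdges k) :
    G.vertex (.inl e) < k :=
  mem_inEdges.1 he ▸ vertex_lt_head (.inl e)

section AddCommMonoid

variable {R : Type*} [AddCommMonoid R]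

lemma sum_outHalves (f : G.HalfEdge → R) (v : Fin (n + 1)) :
    ∑ h ∈ G.outHalves v, f h = (∑ e, if G.src e = v then f (.inl e) else 0) +
      ∑ e : {e : E // G.sign e = 1}, if G.tgt e = v then f (.inr e) else 0 := by
  rw [outHalves, Finset.sum_filter, Fintype.sum_sum_type]
  simp only [vertex, Sum.elim_inl, Sum.elim_inr, Fin.val_inj]

lemma sum_inEdges (f : E → R) (v : Fin (n + 1)) :
    ∑ e ∈ G.inEdges v, f e =
      ∑ e : {e : E // G.sign e = -1}, if G.tgt e = v then f e else 0 := by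
  rw [← Finset.sum_subtype {e | G.sign e = -1} (by simp) fun e => if G.tgt e = v then f e else 0,
    ← Finset.sum_filter, Finset.filter_filter]
  exact Finset.sum_congr (by ext; simp [head_eq_iff]) fun _ _ => rfl

/-- At the vertex `v` the incoming flow equals the outgoing flow, where both halves of a positive
edge are outgoing. -/
def IsConservedAt (G : SignedGraph n E) (f : E → R) (v : ℕ) : Prop :=
  ∑ e ∈ G.inEdges v, f e = ∑ h ∈ G.outHalves v, f (G.edge h)

end AddCommMonoid

variable (G) (R : Type*) [CommRing R]

/-- The flows that are conserved at every vertex but the first. -/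
def conservedFlows : Submodule R (E → R) where
  carrier := {f | ∀ v ∈ Finset.Icc 1 n, G.IsConservedAt f v}
  zero_mem' := fun v _ => by simp [IsConservedAt]
  add_mem' := fun hf hg v hv => by
    simpa only [IsConservedAt, Pi.add_apply, Finset.sum_add_distrib] using
      congrArg₂ (· + ·) (hf v hv) (hg v hv)
  smul_mem' := fun c f hf v hv => by
    simpa only [IsConservedAt, Pi.smul_apply, Finset.smul_sum] using congrArg (c • ·) (hf v hv)

/-- The flow into the sink, that is, the total flow on the positive edges. -/
def sinkFlow : (E → R) →ₗ[R] R := ∑ e ∈ G.inEdges (n + 1), LinearMap.proj e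

variable {G R}

lemma mem_conservedFlows {f : E → R} :
    f ∈ G.conservedFlows R ↔ ∀ v ∈ Finset.Icc 1 n, G.IsConservedAt f v := Iff.rfl

lemma sinkFlow_apply (f : E → R) : G.sinkFlow R f = ∑ e ∈ G.inEdges (n + 1), f e := by
  simp [sinkFlow]

lemma rootMatrix_mulVec (f : E → ℝ) (v : Fin (n + 1)) :
    (G.rootMatrix *ᵥ f) v =
      ∑ h ∈ G.outHalves v, f (G.edge h) - ∑ e ∈ G.inEdges v, f e := by
  have sum_subtype : ∀ c : ℤˣ, ∑ e : {e // G.sign e = c}, (if G.tgt e = v then f e else 0) =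
      ∑ e, if G.sign e = c then if G.tgt e = v then f e else 0 else 0 := fun c => by
    rw [← Finset.sum_subtype {e | G.sign e = c} (by simp) fun e => if G.tgt e = v then f e else 0,
      Finset.sum_filter]
  rw [sum_outHalves, sum_inEdges]
  simp only [edge, Sum.elim_inl, Sum.elim_inr, id]
  rw [sum_subtype, sum_subtype, ← Finset.sum_add_distrib, ← Finset.sum_sub_distrib]
  refine Finset.sum_congr rfl fun e _ => ?_
  simp only [rootMatrix, root, Matrix.of_apply, Pi.add_apply, Pi.smul_apply, Pi.single_apply,
    eq_comm (a := v)]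
  rcases Int.units_eq_one_or (G.sign e) with h | h <;> rw [h] <;>
    by_cases h1 : G.src e = v <;> by_cases h2 : G.tgt e = v <;> simp [h1, h2]
  ring

lemma sum_rootMatrix_mulVec (f : E → ℝ) :
    ∑ v, (G.rootMatrix *ᵥ f) v = 2 * G.sinkFlow ℝ f := by
  have column_sum : ∀ e, ∑ v, G.rootMatrix v e = if G.head e = n + 1 then 2 else 0 := by
    intro e
    simp only [rootMatrix, root, Matrix.of_apply, Pi.add_apply, Pi.smul_apply, Pi.single_apply,
      head_eq_succ_iff]
    rcases Int.units_eq_one_or (G.sign e) with h | h <;> rw [h] <;>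
      simp [Finset.sum_add_distrib]
    norm_num
  simp only [Matrix.mulVec, dotProduct]
  rw [Finset.sum_comm, sinkFlow_apply, inEdges, Finset.sum_filter, Finset.mul_sum]
  simp only [← Finset.sum_mul, column_sum, ite_mul, zero_mul, mul_ite, mul_zero]

lemma mem_conservedFlows_iff_rootMatrix {f : E → ℝ} :
    f ∈ G.conservedFlows ℝ ↔ ∀ v, v ≠ 0 → (G.rootMatrix *ᵥ f) v = 0 := by
  simp only [mem_conservedFlows, IsConservedAt, rootMatrix_mulVec, sub_eq_zero, Finset.mem_Icc]
  constructor
  · exact fun h v hv => (h v ⟨Nat.one_le_iff_ne_zero.2 (Fin.val_ne_zero_iff.2 hv), by omega⟩).symm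
  · exact fun h v hv => (h ⟨v, by omega⟩ (Fin.val_ne_zero_iff.1 (by simp; omega))).symm

lemma rootMatrix_mulVec_eq_single_iff {f : E → ℝ} {c : ℝ} :
    G.rootMatrix *ᵥ f = Pi.single 0 (2 * c) ↔ f ∈ G.conservedFlows ℝ ∧ G.sinkFlow ℝ f = c := by
  have total := sum_rootMatrix_mulVec (G := G) f
  rw [mem_conservedFlows_iff_rootMatrix]
  constructor
  · intro h
    refine ⟨fun v hv => by rw [h, Pi.single_eq_of_ne hv], ?_⟩
    rw [h, Finset.sum_pi_single'] at total
    simpa using total.symm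
  · rintro ⟨h, rfl⟩
    rw [Finset.sum_eq_single 0 (fun v _ hv => h v hv) (by simp)] at total
    funext v
    rcases eq_or_ne v 0 with rfl | hv
    · rw [total, Pi.single_eq_same]
    · rw [h v hv, Pi.single_eq_of_ne hv]

lemma mem_flowPolytope_iff {f : E → ℝ} :
    f ∈ G.flowPolytope (Pi.single 0 2) ↔
      (∀ e, 0 ≤ f e) ∧ f ∈ G.conservedFlows ℝ ∧ G.sinkFlow ℝ f = 1 := by
  rw [← rootMatrix_mulVec_eq_single_iff, mul_one]
  have cast_single : (fun v => ((Pi.single 0 2 : Fin (n + 1) → ℤ) v : ℝ)) = Pi.single 0 2 := by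
    funext v
    simp [Pi.single_apply, apply_ite]
  rw [← cast_single]
  rfl

lemma mem_flowSpace_iff {f : E → ℝ} :
    f ∈ G.flowSpace ↔ f ∈ G.conservedFlows ℝ ∧ G.sinkFlow ℝ f = 0 := by
  rw [← rootMatrix_mulVec_eq_single_iff, mul_zero, Pi.single_zero]
  rfl

lemma intVec_mem_conservedFlows {u : E → ℤ} :
    intVec u ∈ G.conservedFlows ℝ ↔ u ∈ G.conservedFlows ℤ := by
  refine forall₂_congr fun v _ => ?_
  simp only [IsConservedAt, intVec_apply]
  exact_mod_cast Iff.rfl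

lemma sinkFlow_intVec (u : E → ℤ) : G.sinkFlow ℝ (intVec u) = G.sinkFlow ℤ u := by
  simp [sinkFlow_apply]

lemma mem_integerPoints_flowSpace_iff {u : E → ℤ} :
    u ∈ integerPoints G.flowSpace ↔ u ∈ G.conservedFlows ℤ ∧ G.sinkFlow ℤ u = 0 := by
  change intVec u ∈ G.flowSpace ↔ _
  rw [mem_flowSpace_iff, intVec_mem_conservedFlows, sinkFlow_intVec, Int.cast_eq_zero]

end Flows

section FreeEdges

variable {G : SignedGraph n E}

/-- A choice of an entering edge `t v` at every vertex `v = 1, …, n`; the other values of `t` are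
irrelevant. -/
def IsParentChoice (G : SignedGraph n E) (t : ℕ → E) : Prop :=
  ∀ v ∈ Finset.Icc 1 n, G.head (t v) = v

open Classical in
/-- The edges not chosen as parents. The flow on them can be prescribed, and then determines a
conserved flow. -/
def freeEdges (G : SignedGraph n E) (t : ℕ → E) : Finset E :=
  {e | G.head e ≤ n → e ≠ t (G.head e)}

variable {t : ℕ → E} {R : Type*} [CommRing R]

lemma mem_freeEdges {e : E} : e ∈ G.freeEdges t ↔ (G.head e ≤ n → e ≠ t (G.head e)) := by
  simp [freeEdges]

lemma mem_freeEdges_of_mem_inEdges_succ {e : E} (he : e ∈ G.inEdges (n + 1)) :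
    e ∈ G.freeEdges t := by
  rw [mem_inEdges] at he
  exact mem_freeEdges.2 fun h => by omega

lemma mem_freeEdges_of_mem_erase [DecidableEq E] {v : ℕ} {e : E}
    (he : e ∈ (G.inEdges v).erase (t v)) : e ∈ G.freeEdges t := by
  obtain ⟨hne, hv⟩ := Finset.mem_erase.1 he
  rw [mem_inEdges] at hv
  exact mem_freeEdges.2 fun _ => hv.symm ▸ hne

lemma isConservedAt_iff [DecidableEq E] (ht : G.IsParentChoice t) {f : E → R} {v : ℕ}
    (hv : v ∈ Finset.Icc 1 n) :
    G.IsConservedAt f v ↔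
      f (t v) = ∑ h ∈ G.outHalves v, f (G.edge h) - ∑ e ∈ (G.inEdges v).erase (t v), f e := by
  rw [IsConservedAt, ← Finset.add_sum_erase _ f (mem_inEdges.2 (ht v hv)), eq_sub_iff_add_eq]

lemma eqOn_of_eqOn_freeEdges (ht : G.IsParentChoice t) {f g : E → R}
    (hf : f ∈ G.conservedFlows R) (hg : g ∈ G.conservedFlows R) {k : ℕ}
    (h : ∀ e ∈ G.freeEdges t, k < G.head e → f e = g e) (e : E) (he : k < G.head e) :
    f e = g e := by
  classical
  induction hm : n + 1 - G.head e using Nat.strong_induction_on generalizing e with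
  | _ m ih =>
    by_cases hfree : e ∈ G.freeEdges t
    · exact h e hfree he
    · simp only [mem_freeEdges, not_forall, not_not] at hfree
      obtain ⟨hle, parent⟩ := hfree
      have hv : G.head e ∈ Finset.Icc 1 n := Finset.mem_Icc.2 ⟨head_pos e, hle⟩
      rw [parent, (isConservedAt_iff ht hv).1 (hf _ hv), (isConservedAt_iff ht hv).1 (hg _ hv)]
      congr 1
      · refine Finset.sum_congr rfl fun h' hh' => ?_
        have later := lt_head_of_mem_outHalves hh'
        exact ih _ (by omega) _ (by omega) rfl
      · refine Finset.sum_congr rfl fun e' he' => h e' (mem_freeEdges_of_mem_erase he') ?_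
        rwa [mem_inEdges.1 (Finset.mem_of_mem_erase he')]

section Update

variable [DecidableEq E]

lemma update_parent_edge {S : Type*} (ht : G.IsParentChoice t) (f : E → S) (x : S) {v w : ℕ}
    (hv : v ∈ Finset.Icc 1 n) (hvw : v ≤ w) {h : G.HalfEdge} (hh : h ∈ G.outHalves w) :
    Function.update f (t v) x (G.edge h) = f (G.edge h) := by
  refine Function.update_of_ne (fun edge_eq => ?_) _ _
  have later := lt_head_of_mem_outHalves hh
  rw [edge_eq, ht v hv] at later
  omega

lemma isConservedAt_update_parent (ht : G.IsParentChoice t) (f : E → R) {v : ℕ}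
    (hv : v ∈ Finset.Icc 1 n) :
    G.IsConservedAt (Function.update f (t v)
      (∑ h ∈ G.outHalves v, f (G.edge h) - ∑ e ∈ (G.inEdges v).erase (t v), f e)) v := by
  rw [isConservedAt_iff ht hv, Function.update_self,
    Finset.sum_congr rfl fun h hh => update_parent_edge ht f _ hv le_rfl hh]
  exact congrArg _ (Finset.sum_congr rfl fun e he =>
    (Function.update_of_ne (Finset.ne_of_mem_erase he) _ _).symm)

lemma IsConservedAt.update_parent (ht : G.IsParentChoice t) {f : E → R} {v w : ℕ}
    (hf : G.IsConservedAt f w) (hv : v ∈ Finset.Icc 1 n) (hvw : v < w) (x : R) :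
    G.IsConservedAt (Function.update f (t v) x) w := by
  rw [IsConservedAt, Finset.sum_congr rfl fun h hh => update_parent_edge ht f x hv hvw.le hh, ← hf]
  refine Finset.sum_congr rfl fun e he => Function.update_of_ne (fun edge_eq => hvw.ne ?_) _ _
  rw [← mem_inEdges.1 he, edge_eq, ht v hv]

end Update

lemma exists_conservedFlow (ht : G.IsParentChoice t) (y : E → R) :
    ∃ f ∈ G.conservedFlows R, ∀ e ∈ G.freeEdges t, f e = y e := by
  classical
  -- The flow on the parent edges is determined vertex by vertex, starting at the vertex `n`.
  suffices partial_flow : ∀ k, ∃ f : E → R,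
      (∀ v ∈ Finset.Icc 1 n, n < v + k → G.IsConservedAt f v) ∧ ∀ e ∈ G.freeEdges t, f e = y e by
    obtain ⟨f, conserved, agrees⟩ := partial_flow n
    exact ⟨f, fun v hv => conserved v hv (by have := Finset.mem_Icc.1 hv; omega), agrees⟩
  intro k
  induction k with
  | zero => exact ⟨y, fun v hv hlt => by have := Finset.mem_Icc.1 hv; omega, fun _ _ => rfl⟩
  | succ k ih =>
    obtain ⟨f, conserved, agrees⟩ := ih
    by_cases hk : n ≤ k
    · exact ⟨f, fun v hv _ => conserved v hv (by have := Finset.mem_Icc.1 hv; omega), agrees⟩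
    have hv : n - k ∈ Finset.Icc 1 n := Finset.mem_Icc.2 ⟨by omega, by omega⟩
    refine ⟨Function.update f (t (n - k)) (∑ h ∈ G.outHalves (n - k), f (G.edge h) -
      ∑ e ∈ (G.inEdges (n - k)).erase (t (n - k)), f e), fun w hw hlt => ?_, fun e he => ?_⟩
    · rcases eq_or_ne w (n - k) with rfl | hne
      · exact isConservedAt_update_parent ht f hv
      · exact (conserved w hw (by omega)).update_parent ht hv (by omega) _
    · rw [Function.update_of_ne, agrees e he]
      rintro rfl
      refine mem_freeEdges.1 he ?_ ?_ <;> rw [ht _ hv]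
      exact (Finset.mem_Icc.1 hv).2

/-- The coordinates on the module of conserved flows given by the flow on the free edges. -/
def freeCoordinates (ht : G.IsParentChoice t) (R : Type*) [CommRing R] :
    G.conservedFlows R ≃ₗ[R] (G.freeEdges t → R) :=
  LinearEquiv.ofBijective
    (LinearMap.funLeft R R (Subtype.val : G.freeEdges t → E) ∘ₗ (G.conservedFlows R).subtype)
    ⟨fun f g hfg => Subtype.ext <| funext fun e =>
      eqOn_of_eqOn_freeEdges ht f.2 g.2 (fun e he _ => congrFun hfg ⟨e, he⟩) e (head_pos e),
    fun y => by
      obtain ⟨f, conserved, agrees⟩ := exists_conservedFlow ht (Function.extend Subtype.val y 0)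
      exact ⟨⟨f, conserved⟩, funext fun e =>
        (agrees e e.2).trans (Subtype.val_injective.extend_apply y 0 e)⟩⟩

/-- The conserved flow with prescribed values on the free edges. -/
def freeFlow (ht : G.IsParentChoice t) (y : G.freeEdges t → R) : E → R :=
  (freeCoordinates ht R).symm y

lemma freeFlow_mem_conservedFlows (ht : G.IsParentChoice t) (y : G.freeEdges t → R) :
    freeFlow ht y ∈ G.conservedFlows R :=
  ((freeCoordinates ht R).symm y).2

lemma freeFlow_apply (ht : G.IsParentChoice t) (y : G.freeEdges t → R) {e : E}
    (he : e ∈ G.freeEdges t) : freeFlow ht y e = y ⟨e, he⟩ :=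
  congrFun ((freeCoordinates ht R).apply_symm_apply y) ⟨e, he⟩

lemma sinkFlow_freeFlow (ht : G.IsParentChoice t) (y : E → R) :
    G.sinkFlow R (freeFlow ht fun e => y e) = ∑ e ∈ G.inEdges (n + 1), y e := by
  rw [sinkFlow_apply]
  exact Finset.sum_congr rfl fun e he =>
    freeFlow_apply ht _ (mem_freeEdges_of_mem_inEdges_succ he)

lemma measurable_freeFlow (ht : G.IsParentChoice t) :
    Measurable (freeFlow ht : (G.freeEdges t → ℝ) → E → ℝ) :=
  ((G.conservedFlows ℝ).subtype ∘ₗ (freeCoordinates ht ℝ).symm.toLinearMap)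
    |>.continuous_of_finiteDimensional.measurable

lemma freeFlow_restrict (ht : G.IsParentChoice t) {f : E → R} (hf : f ∈ G.conservedFlows R) :
    freeFlow ht (fun e => f e) = f :=
  congrArg Subtype.val ((freeCoordinates ht R).symm_apply_apply ⟨f, hf⟩)

/-- The lattice basis of the integer conserved flows that is dual to the free edges. -/
def freeBasis (ht : G.IsParentChoice t) : Module.Basis (G.freeEdges t) ℤ (G.conservedFlows ℤ) :=
  .ofEquivFun (freeCoordinates ht ℤ)

lemma realCombination_mem_conservedFlows {κ : Type*} [Fintype κ]
    (b : Module.Basis κ ℤ (G.conservedFlows ℤ)) (y : κ → ℝ) :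
    realCombination b y ∈ G.conservedFlows ℝ :=
  Submodule.sum_mem _ fun k _ => Submodule.smul_mem _ _ (intVec_mem_conservedFlows.2 (b k).2)

lemma realCombination_freeBasis (ht : G.IsParentChoice t) (y : G.freeEdges t → ℝ) :
    realCombination (freeBasis ht) y = freeFlow ht y := by
  classical
  rw [← freeFlow_restrict ht (realCombination_mem_conservedFlows (freeBasis ht) y)]
  congr 1
  funext e
  have basis_apply : ∀ k, (freeBasis ht k : E → ℤ) e = if k = e then 1 else 0 := fun k => by
    rw [freeBasis, Module.Basis.coe_ofEquivFun]
    refine (freeFlow_apply ht _ e.2).trans ?_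
    simp only [Subtype.coe_eta, Pi.single_apply, eq_comm]
  simp [realCombination_apply, basis_apply]

lemma exists_realCombination_eq (ht : G.IsParentChoice t) {κ : Type*} [Fintype κ]
    (b : Module.Basis κ ℤ (G.conservedFlows ℤ)) {f : E → ℝ} (hf : f ∈ G.conservedFlows ℝ) :
    ∃ y, realCombination b y = f :=
  ⟨_, (realCombination_toMatrix_mulVec (freeBasis ht) b _).trans
    ((realCombination_freeBasis ht _).trans (freeFlow_restrict ht hf))⟩

lemma card_freeEdges_add (ht : G.IsParentChoice t) :
    (G.freeEdges t).card + n = Fintype.card E := by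
  classical
  have compl_eq : (G.freeEdges t)ᶜ = (Finset.Icc 1 n).image t := by
    ext e
    simp only [Finset.mem_compl, mem_freeEdges, not_forall, not_not, Finset.mem_image]
    constructor
    · exact fun ⟨hle, parent⟩ => ⟨_, Finset.mem_Icc.2 ⟨head_pos e, hle⟩, parent.symm⟩
    · rintro ⟨v, hv, rfl⟩
      rw [ht v hv]
      exact ⟨(Finset.mem_Icc.1 hv).2, rfl⟩
  have t_injOn : Set.InjOn t (Finset.Icc 1 n) := fun v hv w hw hvw => by
    rw [← ht v hv, hvw, ht w hw]
  rw [← Finset.card_add_card_compl (G.freeEdges t), compl_eq, Finset.card_image_of_injOn t_injOn,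
    Nat.card_Icc, Nat.add_sub_cancel]

lemma finrank_conservedFlows_add (ht : G.IsParentChoice t) :
    Module.finrank ℝ (G.conservedFlows ℝ) + n = Fintype.card E := by
  rw [(freeCoordinates ht ℝ).finrank_eq, Module.finrank_pi, Fintype.card_coe,
    card_freeEdges_add ht]

end FreeEdges

section PartialFlows

variable {G : SignedGraph n E}

/-- At the vertex `v` the integer flow on the half-edges has netflow `indeg v - 1`; the equation is
written without subtraction. -/
def IsBalancedAt (b : G.HalfEdge → ℕ) (v : ℕ) : Prop :=
  ∑ e ∈ G.inEdges v, (b (.inl e) + 1) = ∑ h ∈ G.outHalves v, b h + 1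

/-- An integer flow on the half-edges at the vertices `1, …, k` that is balanced there. -/
def IsPartialFlow (k : ℕ) (b : G.HalfEdge → ℕ) : Prop :=
  (∀ h, b h ≠ 0 → G.vertex h ∈ Finset.Icc 1 k) ∧ ∀ v ∈ Finset.Icc 1 k, IsBalancedAt b v

open Classical in
/-- The flows on the half-edges at `k + 1` that extend the partial flow `b` from the vertices up to
`k` to the vertices up to `k + 1`, provided that some edge enters `k + 1`. -/
def extensions (k : ℕ) (b : G.HalfEdge → ℕ) : Finset (G.HalfEdge → ℕ) :=
  (G.outHalves (k + 1)).piAntidiag (∑ e ∈ G.inEdges (k + 1), (b (.inl e) + 1) - 1)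

lemma isBalancedAt_congr {b b' : G.HalfEdge → ℕ} {v : ℕ} (hb : ∀ h, G.vertex h ≤ v → b h = b' h) :
    IsBalancedAt b v ↔ IsBalancedAt b' v := by
  rw [IsBalancedAt, Finset.sum_congr rfl fun e he => congrArg (· + 1) (hb (.inl e) ?_),
    Finset.sum_congr rfl fun h hh => hb h (mem_outHalves.1 hh).le, IsBalancedAt]
  exact (vertex_inl_lt_of_mem_inEdges he).le

lemma isPartialFlow_zero {b : G.HalfEdge → ℕ} : IsPartialFlow 0 b ↔ b = 0 := by
  simp [IsPartialFlow, funext_iff]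

lemma IsPartialFlow.eq_zero {k : ℕ} {b : G.HalfEdge → ℕ} (hb : IsPartialFlow k b) {h : G.HalfEdge}
    (hh : k < G.vertex h) : b h = 0 := by
  by_contra hne
  exact (Finset.mem_Icc.1 (hb.1 h hne)).2.not_gt hh

lemma mem_extensions {k : ℕ} {b b' : G.HalfEdge → ℕ} :
    b' ∈ extensions k b ↔
      ∑ h ∈ G.outHalves (k + 1), b' h = ∑ e ∈ G.inEdges (k + 1), (b (.inl e) + 1) - 1 ∧
        ∀ h, b' h ≠ 0 → G.vertex h = k + 1 := by
  classical
  simp [extensions, Finset.mem_piAntidiag]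

lemma eq_zero_of_mem_extensions {k : ℕ} {b b' : G.HalfEdge → ℕ} (hb' : b' ∈ extensions k b)
    {h : G.HalfEdge} (hh : G.vertex h ≠ k + 1) : b' h = 0 := by
  by_contra hne
  exact hh ((mem_extensions.1 hb').2 h hne)

lemma IsPartialFlow.add_extension {k : ℕ} (hk : (G.inEdges (k + 1)).Nonempty)
    {b b' : G.HalfEdge → ℕ} (hb : IsPartialFlow k b) (hb' : b' ∈ extensions k b) :
    IsPartialFlow (k + 1) (b + b') := by
  have agrees : ∀ h, G.vertex h ≤ k → (b + b') h = b h := fun h hh => by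
    rw [Pi.add_apply, eq_zero_of_mem_extensions hb' (by omega), add_zero]
  refine ⟨fun h hne => ?_, fun v hv => ?_⟩
  · rcases lt_trichotomy (G.vertex h) (k + 1) with hh | hh | hh
    · rw [agrees h (by omega)] at hne
      have := Finset.mem_Icc.1 (hb.1 h hne)
      exact Finset.mem_Icc.2 ⟨this.1, by omega⟩
    · exact Finset.mem_Icc.2 ⟨by omega, hh.le⟩
    · rw [Pi.add_apply, hb.eq_zero (by omega), eq_zero_of_mem_extensions hb' hh.ne'] at hne
      exact absurd rfl hne
  obtain ⟨hv1, hvk⟩ := Finset.mem_Icc.1 hv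
  rcases hvk.lt_or_eq with hlt | rfl
  · exact (isBalancedAt_congr fun h hh => agrees h (by omega)).2
      (hb.2 v (Finset.mem_Icc.2 ⟨hv1, by omega⟩))
  · have incoming : ∀ e ∈ G.inEdges (k + 1), (b + b') (.inl e) + 1 = b (.inl e) + 1 :=
        fun e he => by
        rw [agrees _ (Nat.lt_succ_iff.1 (vertex_inl_lt_of_mem_inEdges he))]
    have outgoing : ∀ h ∈ G.outHalves (k + 1), (b + b') h = b' h := fun h hh => by
      rw [Pi.add_apply, hb.eq_zero (by rw [mem_outHalves.1 hh]; omega), zero_add]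
    rw [IsBalancedAt, Finset.sum_congr rfl incoming, Finset.sum_congr rfl outgoing,
      (mem_extensions.1 hb').1, Nat.sub_add_cancel]
    obtain ⟨e, he⟩ := hk
    exact (Nat.le_add_left 1 _).trans (Finset.single_le_sum (f := fun e => b (.inl e) + 1)
      (fun _ _ => Nat.zero_le _) he)

lemma IsPartialFlow.exists_add_extension {k : ℕ} {b : G.HalfEdge → ℕ}
    (hb : IsPartialFlow (k + 1) b) :
    ∃ b₁, IsPartialFlow k b₁ ∧ ∃ b₂ ∈ extensions k b₁, b₁ + b₂ = b := by
  let b₁ : G.HalfEdge → ℕ := fun h => if G.vertex h ≤ k then b h else 0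
  let b₂ : G.HalfEdge → ℕ := fun h => if G.vertex h = k + 1 then b h else 0
  have agrees : ∀ h, G.vertex h ≤ k → b h = b₁ h := fun h hh => (if_pos hh).symm
  refine ⟨b₁, ⟨fun h hne => ?_, fun v hv => ?_⟩, b₂, mem_extensions.2 ⟨?_, fun h hne => ?_⟩,
    funext fun h => ?_⟩
  · obtain ⟨hh, hne⟩ := ite_ne_right_iff.1 hne
    exact Finset.mem_Icc.2 ⟨(Finset.mem_Icc.1 (hb.1 h hne)).1, hh⟩
  · obtain ⟨hv1, hvk⟩ := Finset.mem_Icc.1 hv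
    exact (isBalancedAt_congr fun h hh => agrees h (hh.trans hvk)).1
      (hb.2 v (Finset.mem_Icc.2 ⟨hv1, by omega⟩))
  · have incoming : ∀ e ∈ G.inEdges (k + 1), b₁ (.inl e) + 1 = b (.inl e) + 1 := fun e he => by
      rw [agrees _ (Nat.lt_succ_iff.1 (vertex_inl_lt_of_mem_inEdges he))]
    rw [Finset.sum_congr rfl incoming, hb.2 (k + 1) (Finset.mem_Icc.2 ⟨by omega, le_rfl⟩),
      Nat.add_sub_cancel]
    exact Finset.sum_congr rfl fun h hh => if_pos (mem_outHalves.1 hh)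
  · exact (ite_ne_right_iff.1 hne).1
  · rcases lt_trichotomy (G.vertex h) (k + 1) with hh | hh | hh
    · simp [b₁, b₂, show G.vertex h ≤ k by omega, hh.ne]
    · simp [b₁, b₂, hh]
    · simp [b₁, b₂, show ¬ G.vertex h ≤ k by omega, hh.ne', hb.eq_zero hh]

variable (G) in
open Classical in
/-- The partial flows on the half-edges at the vertices `1, …, k`, constructed vertex by vertex; see
`mem_partialFlows`. -/
def partialFlows : ℕ → Finset (G.HalfEdge → ℕ)
  | 0 => {0}
  | k + 1 => (partialFlows k).biUnion fun b => (extensions k b).image (b + ·)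

lemma mem_partialFlows (hin : ∀ v ∈ Finset.Icc 1 n, (G.inEdges v).Nonempty) {k : ℕ} (hk : k ≤ n)
    {b : G.HalfEdge → ℕ} : b ∈ G.partialFlows k ↔ IsPartialFlow k b := by
  induction k generalizing b with
  | zero => rw [partialFlows, Finset.mem_singleton, isPartialFlow_zero]
  | succ k ih =>
    simp only [partialFlows, Finset.mem_biUnion, Finset.mem_image, ih (by omega)]
    refine ⟨?_, IsPartialFlow.exists_add_extension⟩
    rintro ⟨b₁, hb₁, b₂, hb₂, rfl⟩
    exact hb₁.add_extension (hin _ (Finset.mem_Icc.2 ⟨by omega, hk⟩)) hb₂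

lemma eq_zero_of_mem_partialFlows {k : ℕ} {b : G.HalfEdge → ℕ} (hb : b ∈ G.partialFlows k)
    {h : G.HalfEdge} (hh : k < G.vertex h) : b h = 0 := by
  induction k generalizing b with
  | zero => rw [Finset.mem_singleton.1 hb, Pi.zero_apply]
  | succ k ih =>
    simp only [partialFlows, Finset.mem_biUnion, Finset.mem_image] at hb
    obtain ⟨b₁, hb₁, b₂, hb₂, rfl⟩ := hb
    rw [Pi.add_apply, ih hb₁ (by omega), eq_zero_of_mem_extensions hb₂ hh.ne', add_zero]

lemma sum_partialFlows_succ {M : Type*} [AddCommMonoid M] (k : ℕ) (F : (G.HalfEdge → ℕ) → M) :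
    ∑ b ∈ G.partialFlows (k + 1), F b =
      ∑ b ∈ G.partialFlows k, ∑ b' ∈ extensions k b, F (b + b') := by
  classical
  have apply_eq : ∀ b ∈ G.partialFlows k, ∀ b' ∈ extensions k b, ∀ h,
      b h = if G.vertex h = k + 1 then 0 else (b + b') h := fun b hb b' hb' h => by
    split_ifs with hh
    · exact eq_zero_of_mem_partialFlows hb (by omega)
    · rw [Pi.add_apply, eq_zero_of_mem_extensions hb' hh, add_zero]
  rw [partialFlows, Finset.sum_biUnion fun b₁ hb₁ b₂ hb₂ hne => Finset.disjoint_left.2 ?_]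
  · exact Finset.sum_congr rfl fun b _ => Finset.sum_image fun _ _ _ _ => add_left_cancel
  · simp only [Finset.mem_image]
    rintro _ ⟨b₁', hb₁', rfl⟩ ⟨b₂', hb₂', sum_eq⟩
    exact hne (funext fun h => by
      rw [apply_eq b₁ hb₁ b₁' hb₁', apply_eq b₂ hb₂ b₂' hb₂', sum_eq])

end PartialFlows

section Elimination

variable {G : SignedGraph n E}

/-- The half-edges of the edges entering a vertex beyond `k` or the sink. -/
def laterHalves (G : SignedGraph n E) (k : ℕ) : Finset G.HalfEdge := {h | k < G.head (G.edge h)}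

@[simp] lemma mem_laterHalves {k : ℕ} {h : G.HalfEdge} :
    h ∈ G.laterHalves k ↔ k < G.head (G.edge h) := by
  simp [laterHalves]

/-- The density `exp (-sinkFlow f)`, multiplied by a divided power of the flow on every half-edge of
the edges entering a vertex beyond `k` or the sink; it vanishes where one of these flows is
negative. Such integrands remain after the edges entering the vertices `1, …, k` have been
integrated out. -/
def flowDensity (k : ℕ) (b : G.HalfEdge → ℕ) (f : E → ℝ) : ℝ≥0∞ :=
  ENNReal.ofReal (Real.exp (-G.sinkFlow ℝ f)) *
    ∏ h ∈ G.laterHalves k, powDensity (b h) (f (G.edge h))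

@[fun_prop]
lemma measurable_flowDensity (k : ℕ) (b : G.HalfEdge → ℕ) : Measurable (flowDensity k b) := by
  have : Measurable (G.sinkFlow ℝ) :=
    (G.sinkFlow ℝ).continuous_of_finiteDimensional.measurable
  unfold flowDensity
  fun_prop

lemma flowDensity_zero (f : E → ℝ) :
    flowDensity (G := G) 0 0 f =
      if ∀ e, 0 ≤ f e then ENNReal.ofReal (Real.exp (-G.sinkFlow ℝ f)) else 0 := by
  rw [flowDensity]
  split_ifs with h
  · rw [Finset.prod_eq_one, mul_one]
    exact fun x _ => by rw [Pi.zero_apply, powDensity_zero, if_pos (h _)]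
  · push Not at h
    obtain ⟨e, he⟩ := h
    rw [Finset.prod_eq_zero (i := .inl e) (mem_laterHalves.2 (head_pos _)) (powDensity_of_neg _ he),
      mul_zero]

lemma laterHalves_eq_disjUnion {k : ℕ} (hk : k < n) :
    G.laterHalves k = ((G.inEdges (k + 1)).map Function.Embedding.inl).disjUnion
      (G.laterHalves (k + 1)) (Finset.disjoint_left.2 fun h h₁ h₂ => by
        obtain ⟨e, he, rfl⟩ := Finset.mem_map.1 h₁
        exact (mem_laterHalves.1 h₂).ne' (mem_inEdges.1 he)) := by
  ext h
  simp only [Finset.mem_disjUnion, Finset.mem_map, mem_inEdges, mem_laterHalves]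
  rcases h with e | e
  · simp only [edge, Sum.elim_inl, id, Function.Embedding.inl_apply, Sum.inl.injEq, exists_eq_right]
    omega
  · simp only [edge, Sum.elim_inr, head_of_pos e.2, Function.Embedding.inl_apply, reduceCtorEq,
      and_false, exists_false, false_or]
    omega

lemma flowDensity_eq_prod_mul {k : ℕ} (hk : k < n) (b : G.HalfEdge → ℕ) (f : E → ℝ) :
    flowDensity k b f =
      (∏ e ∈ G.inEdges (k + 1), powDensity (b (.inl e)) (f e)) * flowDensity (k + 1) b f := by
  rw [flowDensity, laterHalves_eq_disjUnion hk, Finset.prod_disjUnion, Finset.prod_map,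
    mul_left_comm]
  rfl

lemma powDensity_mul_flowDensity {k : ℕ} {b : G.HalfEdge → ℕ}
    (hb : ∀ h ∈ G.outHalves (k + 1), b h = 0) (f : E → ℝ) :
    powDensity (∑ e ∈ G.inEdges (k + 1), (b (.inl e) + 1) - 1)
        (∑ h ∈ G.outHalves (k + 1), f (G.edge h)) * flowDensity (k + 1) b f =
      ∑ b' ∈ extensions k b, flowDensity (k + 1) (b + b') f := by
  classical
  have subset : G.outHalves (k + 1) ⊆ G.laterHalves (k + 1) := fun h hh =>
    mem_laterHalves.2 (lt_head_of_mem_outHalves hh)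
  have split : ∀ b' ∈ extensions k b, flowDensity (k + 1) (b + b') f =
      ENNReal.ofReal (Real.exp (-G.sinkFlow ℝ f)) *
        ((∏ h ∈ G.laterHalves (k + 1) \ G.outHalves (k + 1), powDensity (b h) (f (G.edge h))) *
          ∏ h ∈ G.outHalves (k + 1), powDensity (b' h) (f (G.edge h))) := fun b' hb' => by
    rw [flowDensity, ← Finset.prod_sdiff subset]
    congr 2 <;> refine Finset.prod_congr rfl fun h hh => ?_
    · rw [Pi.add_apply, eq_zero_of_mem_extensions hb', add_zero]
      exact fun hv => (Finset.mem_sdiff.1 hh).2 (mem_outHalves.2 hv)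
    · rw [Pi.add_apply, hb h hh, zero_add]
  have multinomial := powDensity_sum (G.outHalves (k + 1))
    (∑ e ∈ G.inEdges (k + 1), (b (.inl e) + 1) - 1) fun h => f (G.edge h)
  rw [Finset.sum_congr rfl split, ← Finset.mul_sum, ← Finset.mul_sum, extensions, ← multinomial,
    flowDensity, ← Finset.prod_sdiff subset, Finset.prod_congr (rfl : G.outHalves (k + 1) = _)
      fun h hh => by rw [hb h hh]]
  ring

variable {t : ℕ → E}

lemma flowDensity_congr (ht : G.IsParentChoice t) {f g : E → ℝ} (hf : f ∈ G.conservedFlows ℝ)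
    (hg : g ∈ G.conservedFlows ℝ) {k : ℕ} (hk : k ≤ n)
    (hfg : ∀ e ∈ G.freeEdges t, k < G.head e → f e = g e) (b : G.HalfEdge → ℕ) :
    flowDensity k b f = flowDensity k b g := by
  have agrees := eqOn_of_eqOn_freeEdges ht hf hg hfg
  rw [flowDensity, flowDensity, sinkFlow_apply, sinkFlow_apply,
    Finset.sum_congr rfl fun e he => agrees e (by rw [mem_inEdges.1 he]; omega),
    Finset.prod_congr rfl fun h hh => by rw [agrees _ (mem_laterHalves.1 hh)]]

/-- Changing the coordinates `y` on the free edges entering `k + 1` only affects the flow on the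
edges entering vertices up to `k + 1`; the parent edge of `k + 1` carries what the others leave of
the outgoing flow. -/
lemma flowDensity_freeFlow_eq [DecidableEq E] (ht : G.IsParentChoice t) {k : ℕ} (hk : k < n)
    (b : G.HalfEdge → ℕ) {y y' : E → ℝ}
    (hy : ∀ e ∉ (G.inEdges (k + 1)).erase (t (k + 1)), y' e = y e) :
    flowDensity k b (freeFlow ht fun e => y' e) =
      flowDensity (k + 1) b (freeFlow ht fun e => y e) *
        ((∏ e ∈ (G.inEdges (k + 1)).erase (t (k + 1)), powDensity (b (.inl e)) (y' e)) *
          powDensity (b (.inl (t (k + 1))))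
            (∑ h ∈ G.outHalves (k + 1), freeFlow ht (fun e => y e) (G.edge h) -
              ∑ e ∈ (G.inEdges (k + 1)).erase (t (k + 1)), y' e)) := by
  have hv : k + 1 ∈ Finset.Icc 1 n := Finset.mem_Icc.2 ⟨by omega, hk⟩
  have conserved := freeFlow_mem_conservedFlows (R := ℝ) ht
  have unchanged : ∀ e ∈ G.freeEdges t, k + 1 < G.head e →
      freeFlow ht (fun e => y' e) e = freeFlow ht (fun e => y e) e := fun e he hlt => by
    rw [freeFlow_apply ht _ he, freeFlow_apply ht _ he, hy]
    exact fun hs => hlt.ne' (mem_inEdges.1 (Finset.mem_of_mem_erase hs))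
  have on_siblings : ∀ e ∈ (G.inEdges (k + 1)).erase (t (k + 1)),
      freeFlow ht (fun e => y' e) e = y' e := fun e he =>
    freeFlow_apply ht _ (mem_freeEdges_of_mem_erase he)
  have on_parent : freeFlow ht (fun e => y' e) (t (k + 1)) =
      ∑ h ∈ G.outHalves (k + 1), freeFlow ht (fun e => y e) (G.edge h) -
        ∑ e ∈ (G.inEdges (k + 1)).erase (t (k + 1)), y' e := by
    rw [(isConservedAt_iff ht hv).1 (conserved _ _ hv), Finset.sum_congr rfl on_siblings]
    exact congrArg (· - _) (Finset.sum_congr rfl fun h hh => eqOn_of_eqOn_freeEdges ht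
      (conserved _) (conserved _) unchanged _ (lt_head_of_mem_outHalves hh))
  rw [flowDensity_eq_prod_mul hk, flowDensity_congr ht (conserved _) (conserved _) hk unchanged,
    ← Finset.mul_prod_erase _ _ (mem_inEdges.2 (ht _ hv)), on_parent,
    Finset.prod_congr rfl fun e he => by rw [on_siblings e he]]
  ring

/-- Integrating out the free edges that enter one vertex is a Dirichlet integral over a simplex; the
resulting power of the outgoing flow is expanded by the multinomial theorem. -/
lemma lmarginal_inEdges_erase [DecidableEq E] (ht : G.IsParentChoice t) {k : ℕ} (hk : k < n)
    {b : G.HalfEdge → ℕ} (hb : ∀ h ∈ G.outHalves (k + 1), b h = 0) (y : E → ℝ) :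
    lmarginal (fun _ : E => (volume : Measure ℝ)) ((G.inEdges (k + 1)).erase (t (k + 1)))
      (fun y => flowDensity k b (freeFlow ht fun e => y e)) y =
    ∑ b' ∈ extensions k b, flowDensity (k + 1) (b + b') (freeFlow ht fun e => y e) := by
  let s := (G.inEdges (k + 1)).erase (t (k + 1))
  let X := ∑ h ∈ G.outHalves (k + 1), freeFlow ht (fun e => y e) (G.edge h)
  let simplexDensity : (E → ℝ) → ℝ≥0∞ := fun y' =>
    (∏ e ∈ s, powDensity (b (.inl e)) (y' e)) *
      powDensity (b (.inl (t (k + 1)))) (X - ∑ e ∈ s, y' e)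
  have exponent : b (.inl (t (k + 1))) + ∑ e ∈ s, (b (.inl e) + 1) =
      ∑ e ∈ G.inEdges (k + 1), (b (.inl e) + 1) - 1 := by
    have parent_mem : t (k + 1) ∈ G.inEdges (k + 1) :=
      mem_inEdges.2 (ht _ (Finset.mem_Icc.2 ⟨by omega, hk⟩))
    have split : ∑ e ∈ G.inEdges (k + 1), (b (.inl e) + 1) =
        b (.inl (t (k + 1))) + 1 + ∑ e ∈ s, (b (.inl e) + 1) :=
      (Finset.add_sum_erase _ _ parent_mem).symm
    omega
  calc lmarginal (fun _ : E => (volume : Measure ℝ)) s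
        (fun y => flowDensity k b (freeFlow ht fun e => y e)) y
      = ∫⁻ z : s → ℝ, flowDensity (k + 1) b (freeFlow ht fun e => y e) *
          simplexDensity (Function.updateFinset y s z) :=
        lintegral_congr fun z => flowDensity_freeFlow_eq ht hk b fun e he => dif_neg he
    _ = flowDensity (k + 1) b (freeFlow ht fun e => y e) *
          lmarginal (fun _ : E => (volume : Measure ℝ)) s simplexDensity y :=
        lintegral_const_mul _
          ((by fun_prop : Measurable simplexDensity).comp measurable_updateFinset)
    _ = ∑ b' ∈ extensions k b, flowDensity (k + 1) (b + b') (freeFlow ht fun e => y e) := by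
        rw [lmarginal_prod_powDensity, exponent, mul_comm, powDensity_mul_flowDensity hb]

/-- The free edges entering a vertex up to `k`. -/
def freeEdgesBelow (G : SignedGraph n E) (t : ℕ → E) (k : ℕ) : Finset E :=
  (G.freeEdges t).filter fun e => G.head e ≤ k

lemma freeEdgesBelow_zero : G.freeEdgesBelow t 0 = ∅ :=
  Finset.filter_false_of_mem fun e _ => (head_pos e).not_ge

lemma freeEdgesBelow_succ [DecidableEq E] {k : ℕ} (hk : k < n) :
    G.freeEdgesBelow t (k + 1) =
      (G.inEdges (k + 1)).erase (t (k + 1)) ∪ G.freeEdgesBelow t k := by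
  ext e
  simp only [freeEdgesBelow, Finset.mem_filter, Finset.mem_union, Finset.mem_erase, mem_inEdges,
    mem_freeEdges]
  rcases lt_trichotomy (G.head e) (k + 1) with he | he | he
  · simp [he.ne, he.le, Nat.lt_succ_iff.1 he]
  · simp [he, show k + 1 ≤ n from hk]
  · simp [he.ne', he.not_ge, show ¬ G.head e ≤ k by omega]

lemma freeEdges_eq_union [DecidableEq E] :
    G.freeEdges t = G.inEdges (n + 1) ∪ G.freeEdgesBelow t n := by
  ext e
  simp only [freeEdgesBelow, Finset.mem_filter, Finset.mem_union, mem_inEdges]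
  refine ⟨fun he => ?_, fun he => ?_⟩
  · have := head_le (G := G) e
    exact (Nat.lt_or_ge n (G.head e)).imp (by omega) fun h => ⟨he, h⟩
  · exact he.elim (fun h => mem_freeEdges_of_mem_inEdges_succ (mem_inEdges.2 h)) And.left

lemma disjoint_inEdges_freeEdgesBelow (k : ℕ) :
    Disjoint (G.inEdges (k + 1)) (G.freeEdgesBelow t k) :=
  Finset.disjoint_left.2 fun e he he' => by
    rw [mem_inEdges] at he
    exact (Finset.mem_filter.1 he').2.not_gt (by omega)

lemma measurable_flowDensity_freeFlow (ht : G.IsParentChoice t) (k : ℕ) (b : G.HalfEdge → ℕ) :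
    Measurable fun y : E → ℝ => flowDensity k b (freeFlow ht fun e => y e) :=
  (measurable_flowDensity k b).comp ((measurable_freeFlow ht).comp (by fun_prop))

lemma lmarginal_freeEdgesBelow [DecidableEq E] (ht : G.IsParentChoice t) {k : ℕ} (hk : k ≤ n) :
    lmarginal (fun _ : E => (volume : Measure ℝ)) (G.freeEdgesBelow t k)
      (fun y => flowDensity (G := G) 0 0 (freeFlow ht fun e => y e)) =
    fun y => ∑ b ∈ G.partialFlows k, flowDensity k b (freeFlow ht fun e => y e) := by
  induction k with
  | zero => simp [freeEdgesBelow_zero, partialFlows]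
  | succ k ih =>
    rw [freeEdgesBelow_succ hk, lmarginal_union _ _ (measurable_flowDensity_freeFlow ht 0 0)
      ((disjoint_inEdges_freeEdgesBelow k).mono_left (Finset.erase_subset _ _)), ih (by omega)]
    funext y
    rw [sum_partialFlows_succ, lmarginal, lintegral_finsetSum]
    · exact Finset.sum_congr rfl fun b hb => lmarginal_inEdges_erase ht hk
        (fun h hh => eq_zero_of_mem_partialFlows hb (by rw [mem_outHalves.1 hh]; omega)) y
    · exact fun b _ => (measurable_flowDensity_freeFlow ht k b).comp measurable_updateFinset

/-- The half-edges of the edge `e`. -/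
def halves (G : SignedGraph n E) (e : E) : Finset G.HalfEdge :=
  open Classical in {h | G.edge h = e}

lemma mem_halves {e : E} {h : G.HalfEdge} : h ∈ G.halves e ↔ G.edge h = e := by simp [halves]

lemma halves_nonempty (e : E) : (G.halves e).Nonempty := ⟨Sum.inl e, mem_halves.2 rfl⟩

lemma flowDensity_last (b : G.HalfEdge → ℕ) (f : E → ℝ) :
    flowDensity n b f = ∏ e ∈ G.inEdges (n + 1),
      (ENNReal.ofReal (Real.exp (-f e)) * ∏ h ∈ G.halves e, powDensity (b h) (f e)) := by
  classical
  have edge_mem : ∀ h ∈ G.laterHalves n, G.edge h ∈ G.inEdges (n + 1) := fun h hh => by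
    have := head_le (G := G) (G.edge h)
    rw [mem_laterHalves] at hh
    exact mem_inEdges.2 (by omega)
  rw [flowDensity, sinkFlow_apply, ← Finset.sum_neg_distrib, Real.exp_sum,
    ENNReal.ofReal_prod_of_nonneg fun _ _ => Real.exp_nonneg _, Finset.prod_mul_distrib,
    ← Finset.prod_fiberwise_of_maps_to edge_mem]
  congr 1
  refine Finset.prod_congr rfl fun e he => Finset.prod_congr ?_ fun h hh => by
    rw [mem_halves.1 hh]
  ext h
  rw [Finset.mem_filter, mem_laterHalves, mem_halves, and_iff_right_iff_imp]
  rintro rfl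
  rw [mem_inEdges.1 he]
  omega

lemma lmarginal_inEdges_succ [DecidableEq E] (ht : G.IsParentChoice t) (b : G.HalfEdge → ℕ)
    (y : E → ℝ) :
    lmarginal (fun _ : E => (volume : Measure ℝ)) (G.inEdges (n + 1))
      (fun y => flowDensity n b (freeFlow ht fun e => y e)) y =
    ∏ e ∈ G.inEdges (n + 1), (Nat.multinomial (G.halves e) b : ℝ≥0∞) := by
  have integrand : (fun y : E → ℝ => flowDensity n b (freeFlow ht fun e => y e)) =
      fun y => ∏ e ∈ G.inEdges (n + 1),
        (ENNReal.ofReal (Real.exp (-y e)) * ∏ h ∈ G.halves e, powDensity (b h) (y e)) := by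
    funext y
    rw [flowDensity_last]
    exact Finset.prod_congr rfl fun e he => by
      rw [freeFlow_apply ht _ (mem_freeEdges_of_mem_inEdges_succ he)]
  rw [integrand, lmarginal_prod _ (G.inEdges (n + 1))
    (g := fun e x => ENNReal.ofReal (Real.exp (-x)) * ∏ h ∈ G.halves e, powDensity (b h) x)
    (fun e => by fun_prop) y]
  exact Finset.prod_congr rfl fun e _ =>
    lintegral_exp_mul_prod_powDensity (halves_nonempty e) b

lemma multinomial_halves (b : G.HalfEdge → ℕ) (e : {e : E // G.sign e = 1}) :
    Nat.multinomial (G.halves e) b = (b (.inl e) + b (.inr e)).choose (b (.inl e)) := by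
  classical
  have halves_eq : G.halves e = {.inl e.1, .inr e} := by
    ext h
    rcases h with e' | e' <;> simp [mem_halves, edge, Subtype.ext_iff]
  rw [halves_eq, Nat.binomial_eq_choose Sum.inl_ne_inr]

lemma lintegral_flowDensity_freeFlow (ht : G.IsParentChoice t) :
    ∫⁻ y, flowDensity (G := G) 0 0 (freeFlow ht y) =
      ∑ b ∈ G.partialFlows n, ∏ e : {e : E // G.sign e = 1},
        ((b (.inl e) + b (.inr e)).choose (b (.inl e)) : ℝ≥0∞) := by
  classical
  have as_marginal : ∫⁻ y, flowDensity (G := G) 0 0 (freeFlow ht y) =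
      lmarginal (fun _ : E => (volume : Measure ℝ)) (G.inEdges (n + 1) ∪ G.freeEdgesBelow t n)
        (fun y => flowDensity (G := G) 0 0 (freeFlow ht fun e => y e)) 0 := by
    rw [← freeEdges_eq_union]
    exact lintegral_congr fun y => congrArg (flowDensity (G := G) 0 0) <|
      congrArg (freeFlow ht) <| funext fun e => by rw [Function.updateFinset, dif_pos e.2]
  rw [as_marginal, lmarginal_union _ _ (measurable_flowDensity_freeFlow ht 0 0)
    (disjoint_inEdges_freeEdgesBelow n), lmarginal_freeEdgesBelow ht le_rfl, lmarginal,
    lintegral_finsetSum]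
  · refine Finset.sum_congr rfl fun b _ => (lmarginal_inEdges_succ ht b 0).trans ?_
    rw [Finset.prod_subtype _ fun _ => mem_inEdges.trans head_eq_succ_iff]
    exact Finset.prod_congr rfl fun e _ => by rw [multinomial_halves]
  · exact fun b _ => (measurable_flowDensity_freeFlow ht n b).comp measurable_updateFinset

end Elimination

section DynamicFlows

variable {G : SignedGraph n E}

lemma card_inEdges (v : Fin (n + 1)) : (G.inEdges v).card = G.indeg v := by
  classical
  rw [indeg, Nat.card_eq_fintype_card, Fintype.card_subtype]
  exact congrArg Finset.card (by ext; simp [head_eq_iff])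

lemma isPartialFlow_iff {b : G.HalfEdge → ℕ} :
    IsPartialFlow n b ↔ ∀ v : Fin (n + 1), ((∑ e ∈ G.inEdges v, b (.inl e) : ℕ) : ℤ) +
      G.shiftedIndeg v = (∑ h ∈ G.outHalves v, b h : ℕ) := by
  have balanced_iff : ∀ v : Fin (n + 1), v ≠ 0 → (IsBalancedAt b v ↔
      ((∑ e ∈ G.inEdges v, b (.inl e) : ℕ) : ℤ) + G.shiftedIndeg v =
        (∑ h ∈ G.outHalves v, b h : ℕ)) := fun v hv => by
    rw [IsBalancedAt, Finset.sum_add_distrib, Finset.sum_const, smul_eq_mul, mul_one, card_inEdges,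
      shiftedIndeg, if_neg hv]
    omega
  have at_zero : ((∑ e ∈ G.inEdges (0 : Fin (n + 1)), b (.inl e) : ℕ) : ℤ) + G.shiftedIndeg 0 =
      (∑ h ∈ G.outHalves (0 : Fin (n + 1)), b h : ℕ) ↔ ∀ h, G.vertex h = 0 → b h = 0 := by
    have no_inEdges : G.inEdges (0 : Fin (n + 1)) = ∅ :=
      Finset.eq_empty_of_forall_notMem fun e he => (head_pos e).ne' (mem_inEdges.1 he)
    rw [no_inEdges, Finset.sum_empty, shiftedIndeg, if_pos rfl, Nat.cast_zero, zero_add, eq_comm,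
      Nat.cast_eq_zero, Finset.sum_eq_zero_iff]
    simp only [mem_outHalves, Fin.val_zero]
  constructor
  · rintro ⟨support, balanced⟩ v
    rcases eq_or_ne v 0 with rfl | hv
    · refine at_zero.2 fun h hh => of_not_not fun hne => ?_
      have := Finset.mem_Icc.1 (support h hne)
      omega
    · exact (balanced_iff v hv).1 (balanced v
        (Finset.mem_Icc.2 ⟨Nat.one_le_iff_ne_zero.2 (Fin.val_ne_zero_iff.2 hv), by omega⟩))
  · refine fun conserved => ⟨fun h hne => ?_, fun v hv => ?_⟩
    · exact Finset.mem_Icc.2 ⟨Nat.one_le_iff_ne_zero.2 fun hh => hne (at_zero.1 (conserved 0) h hh),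
        Nat.lt_succ_iff.1 (vertex_lt h)⟩
    · obtain ⟨hv1, hvn⟩ := Finset.mem_Icc.1 hv
      exact (balanced_iff ⟨v, by omega⟩ (Fin.val_ne_zero_iff.1 (by simp; omega))).2 (conserved _)

lemma sum_neg_add_sum_pos {M : Type*} [AddCommMonoid M] (f : E → M) :
    ∑ e : {e : E // G.sign e = -1}, f e + ∑ e : {e : E // G.sign e = 1}, f e = ∑ e, f e := by
  rw [← Fintype.sum_subtype_add_sum_subtype (G.sign · = -1) f]
  have sign_eq_one_iff : ∀ e, G.sign e = 1 ↔ ¬ G.sign e = -1 := fun _ => by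
    rw [← ne_eq, Int.units_ne_iff_eq_neg, neg_neg]
  exact congrArg _ (Fintype.sum_equiv (Equiv.subtypeEquivRight sign_eq_one_iff)
    (fun e => f e) (fun e => f e) fun _ => rfl)

lemma sum_right_add_sum_extra {l : {e : E // G.sign e = 1} → ℕ}
    (g : (e : {e : E // G.sign e = 1}) → Fin (l e + 1) → ℕ) (v : Fin (n + 1)) :
    (∑ e : {e : E // G.sign e = 1}, if G.tgt e = v then g e 0 else 0) +
        (∑ e : {e : E // G.sign e = 1}, if G.tgt e = v then ∑ k : Fin (l e), g e k.succ else 0) =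
      ∑ e : {e : E // G.sign e = 1}, if G.tgt e = v then ∑ k, g e k else 0 := by
  simp only [← Finset.sum_add_distrib, Fin.sum_univ_succ, ite_add_ite, add_zero]

lemma isPartialFlow_iff_dynamic {b : E → ℕ}
    {g : (e : {e : E // G.sign e = 1}) → Fin (b e + 1) → ℕ} :
    IsPartialFlow (G := G) n (Sum.elim b fun e => ∑ k, g e k) ↔ ∀ v : Fin (n + 1),
      ((∑ e : {e : E // G.sign e = -1}, if G.tgt e = v then b e else 0 : ℕ) : ℤ) +
          G.shiftedIndeg v =
        ((∑ e : {e : E // G.sign e = -1}, if G.src e = v then b e else 0 : ℕ) : ℤ) +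
          ((∑ e : {e : E // G.sign e = 1}, if G.src e = v then b e else 0 : ℕ) : ℤ) +
          ((∑ e : {e : E // G.sign e = 1}, if G.tgt e = v then g e 0 else 0 : ℕ) : ℤ) +
          ((∑ e : {e : E // G.sign e = 1},
            if G.tgt e = v then ∑ k : Fin (b e), g e k.succ else 0 : ℕ) : ℤ) := by
  refine isPartialFlow_iff.trans (forall_congr' fun v => ?_)
  rw [sum_outHalves, sum_inEdges, add_assoc ((_ : ℤ) + _), ← Nat.cast_add (∑ _, _) (∑ _, _),
    ← Nat.cast_add (∑ _, _) (∑ _, _), ← Nat.cast_add, sum_right_add_sum_extra,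
    sum_neg_add_sum_pos fun e => if G.src e = v then b e else 0]
  rfl

/-- An integer flow on the half-edges, together with a distribution of the flow on every right half
over the original right half-edge and the extra ones, determines a dynamic flow. -/
def toDynamicFlow (x : Σ b : {b : G.HalfEdge → ℕ // IsPartialFlow n b},
      (e : {e : E // G.sign e = 1}) →
        {g : Fin (b.1 (.inl e) + 1) → ℕ // ∑ k, g k = b.1 (.inr e)}) :
    G.DynamicFlow G.shiftedIndeg where
  flow e := x.1.1 (.inl e)
  left e := x.1.1 (.inl e)
  right e := (x.2 e).1 0
  extra e k := (x.2 e).1 k.succ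
  conservation := isPartialFlow_iff_dynamic.1 <| by
    convert x.1.2 using 1
    funext h
    rcases h with e | e
    exacts [rfl, (x.2 e).2]

lemma toDynamicFlow_injective : Function.Injective (toDynamicFlow (G := G)) := by
  rintro ⟨⟨b, hb⟩, g⟩ ⟨⟨b', hb'⟩, g'⟩ h
  simp only [toDynamicFlow, DynamicFlow.mk.injEq] at h
  obtain ⟨flow_eq, left_eq, right_eq, extra_eq⟩ := h
  obtain ⟨bl, br, rfl⟩ : ∃ bl br, b = Sum.elim bl br := ⟨_, _, (Sum.elim_comp_inl_inr b).symm⟩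
  obtain ⟨bl', br', rfl⟩ : ∃ bl br, b' = Sum.elim bl br := ⟨_, _, (Sum.elim_comp_inl_inr b').symm⟩
  obtain rfl : bl = bl' := funext fun e =>
    (Int.units_eq_one_or (G.sign e)).elim (fun he => congrFun left_eq ⟨e, he⟩)
      fun he => congrFun flow_eq ⟨e, he⟩
  have distribution_eq : ∀ e, (g e).1 = (g' e).1 := fun e => funext <|
    Fin.cases (congrFun right_eq e) fun k => congrFun (congrFun (eq_of_heq extra_eq) e) k
  obtain rfl : br = br' := funext fun e => by
    have total := (g e).2
    rw [distribution_eq e] at total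
    exact total.symm.trans (g' e).2
  obtain rfl : g = g' := funext fun e => Subtype.ext (distribution_eq e)
  rfl

lemma toDynamicFlow_surjective : Function.Surjective (toDynamicFlow (G := G)) := by
  classical
  rintro ⟨flow, left, right, extra, conservation⟩
  obtain ⟨b, rfl, rfl⟩ : ∃ b : E → ℕ, flow = (fun e => b e.1) ∧ left = fun e => b e.1 :=
    ⟨fun e => if h : G.sign e = 1 then left ⟨e, h⟩ else
        flow ⟨e, (Int.units_eq_one_or _).resolve_left h⟩,
      funext fun e => Eq.symm (dif_neg (by rw [e.2]; decide : ¬ G.sign e = 1)),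
      funext fun e => Eq.symm (dif_pos (c := G.sign e = 1) e.2)⟩
  let g : (e : {e : E // G.sign e = 1}) → Fin (b e + 1) → ℕ := fun e =>
    Fin.cons (right e) (extra e)
  exact ⟨⟨⟨Sum.elim b fun e => ∑ k, g e k, isPartialFlow_iff_dynamic.2 conservation⟩,
    fun e => ⟨g e, rfl⟩⟩, rfl⟩

lemma card_sum_eq (l r : ℕ) :
    Nat.card {g : Fin (l + 1) → ℕ // ∑ k, g k = r} = (l + r).choose l := by
  rw [← Nat.card_congr (Sym.equivNatSumOfFintype (Fin (l + 1)) r), Nat.card_eq_fintype_card,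
    Sym.card_sym_eq_multichoose, Fintype.card_fin, Nat.multichoose_eq,
    show l + 1 + r - 1 = l + r by omega, Nat.choose_symm_add]

lemma dynamicKostant_eq_sum (hin : ∀ v ∈ Finset.Icc 1 n, (G.inEdges v).Nonempty) :
    ((G.dynamicKostant G.shiftedIndeg : ℕ∞) : ℝ≥0∞) =
      ∑ b ∈ G.partialFlows n, ∏ e : {e : E // G.sign e = 1},
        ((b (.inl e) + b (.inr e)).choose (b (.inl e)) : ℝ≥0∞) := by
  have finite_distributions : ∀ l r : ℕ, Finite {g : Fin (l + 1) → ℕ // ∑ k, g k = r} :=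
    fun l r => Nat.finite_of_card_ne_zero <| by
      rw [card_sum_eq]
      exact (Nat.choose_pos (Nat.le_add_right l r)).ne'
  let _ : Fintype {b : G.HalfEdge → ℕ // IsPartialFlow n b} :=
    Fintype.subtype (G.partialFlows n) fun _ => mem_partialFlows hin le_rfl
  rw [dynamicKostant, ← ENat.card_congr (Equiv.ofBijective toDynamicFlow
      ⟨toDynamicFlow_injective, toDynamicFlow_surjective⟩),
    ENat.card_eq_coe_natCard, Nat.card_sigma, ENat.toENNReal_coe]
  simp only [Nat.card_pi, card_sum_eq, Nat.cast_sum, Nat.cast_prod]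
  exact (Finset.sum_subtype _ (fun _ => mem_partialFlows hin le_rfl) fun b : G.HalfEdge → ℕ =>
    ∏ e : {e : E // G.sign e = 1}, ((b (.inl e) + b (.inr e)).choose (b (.inl e)) : ℝ≥0∞)).symm

end DynamicFlows

section Volume

variable {G : SignedGraph n E} {t : ℕ → E}

lemma exists_sinkFlow_eq_one (ht : G.IsParentChoice t) {e : E} (he : G.sign e = 1) :
    ∃ w ∈ G.conservedFlows ℤ, G.sinkFlow ℤ w = 1 := by
  classical
  refine ⟨freeFlow ht fun e' => (Pi.single e 1 : E → ℤ) e', freeFlow_mem_conservedFlows ht _, ?_⟩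
  rw [sinkFlow_freeFlow, Finset.sum_pi_single', if_pos (mem_inEdges.2 (head_eq_succ_iff.2 he))]

variable {w : E → ℤ}

/-- The lattice basis of the integer conserved flows that consists of a flow `w` with one unit of
flow into the sink, followed by a lattice basis of the flow space. -/
def sinkBasis (hw : w ∈ G.conservedFlows ℤ) (hw₁ : G.sinkFlow ℤ w = 1) :
    Module.Basis (Fin (Module.finrank ℤ (integerPoints G.flowSpace) + 1)) ℤ (G.conservedFlows ℤ) :=
  .mkFinConsOfLE w hw (Module.finBasis ℤ (integerPoints G.flowSpace))
    (fun _ hu => (mem_integerPoints_flowSpace_iff.1 hu).1)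
    (fun c u hu hcu => by
      have sink_eq := congrArg (G.sinkFlow ℤ) hcu
      rwa [map_add, map_smul, hw₁, (mem_integerPoints_flowSpace_iff.1 hu).2, add_zero, smul_eq_mul,
        mul_one, map_zero] at sink_eq)
    fun z hz => ⟨-G.sinkFlow ℤ z, mem_integerPoints_flowSpace_iff.2
      ⟨add_mem hz (Submodule.smul_mem _ _ hw), by
        rw [map_add, map_smul, hw₁, smul_eq_mul, mul_one, add_neg_cancel]⟩⟩

lemma realCombination_sinkBasis (hw : w ∈ G.conservedFlows ℤ) (hw₁ : G.sinkFlow ℤ w = 1)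
    (a : ℝ) (z : Fin (Module.finrank ℤ (integerPoints G.flowSpace)) → ℝ) :
    realCombination (sinkBasis hw hw₁) (Fin.cons a z) =
      a • intVec w + realCombination (Module.finBasis ℤ (integerPoints G.flowSpace)) z := by
  simp [realCombination_apply, Fin.sum_univ_succ, sinkBasis, Module.Basis.coe_mkFinConsOfLE]

lemma sinkFlow_realCombination_sinkBasis (hw : w ∈ G.conservedFlows ℤ) (hw₁ : G.sinkFlow ℤ w = 1)
    (y : Fin (Module.finrank ℤ (integerPoints G.flowSpace) + 1) → ℝ) :
    G.sinkFlow ℝ (realCombination (sinkBasis hw hw₁) y) = y 0 := by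
  have flowSpace_sink : ∀ k, G.sinkFlow ℝ
      (intVec (Module.finBasis ℤ (integerPoints G.flowSpace) k : E → ℤ)) = 0 := fun k =>
    (mem_flowSpace_iff.1 (Module.finBasis ℤ (integerPoints G.flowSpace) k).2).2
  rw [← Fin.cons_self_tail y, realCombination_sinkBasis]
  simp [realCombination_apply, flowSpace_sink, sinkFlow_intVec, hw₁]

lemma exists_add_realCombination_eq (hw : w ∈ G.conservedFlows ℤ) (hw₁ : G.sinkFlow ℤ w = 1)
    (ht : G.IsParentChoice t) {p : E → ℝ} (hp : p ∈ G.flowPolytope (Pi.single 0 2)) :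
    ∃ c, intVec w + realCombination (Module.finBasis ℤ (integerPoints G.flowSpace)) c = p := by
  obtain ⟨-, conserved, sink⟩ := mem_flowPolytope_iff.1 hp
  obtain ⟨y, rfl⟩ := exists_realCombination_eq ht (sinkBasis hw hw₁) conserved
  rw [sinkFlow_realCombination_sinkBasis] at sink
  refine ⟨Fin.tail y, ?_⟩
  rw [← one_smul ℝ (intVec w), ← realCombination_sinkBasis hw hw₁, ← sink, Fin.cons_self_tail]

lemma normalizedVolumeIn_flowSpace (hw : w ∈ G.conservedFlows ℤ) (hw₁ : G.sinkFlow ℤ w = 1)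
    (ht : G.IsParentChoice t) :
    normalizedVolumeIn G.flowSpace (G.flowPolytope (Pi.single 0 2)) =
      ∫⁻ y, flowDensity (G := G) 0 0 (freeFlow ht y) := by
  let b := sinkBasis hw hw₁
  let C := {y | ∀ e, 0 ≤ realCombination b y e}
  have measurableSet_C : MeasurableSet C := by
    simp only [C, Set.ofPred_forall]
    exact MeasurableSet.iInter fun e => measurableSet_le measurable_const
      ((measurable_pi_apply e).comp (measurable_realCombination b))
  have smul_mem : ∀ a : ℝ, 0 < a → ∀ y ∈ C, a • y ∈ C := fun a ha y hy e => by
    rw [map_smul]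
    exact mul_nonneg ha.le (hy e)
  have sink_nonneg : ∀ y ∈ C, 0 ≤ y 0 := fun y hy => by
    rw [← sinkFlow_realCombination_sinkBasis hw hw₁ y, sinkFlow_apply]
    exact Finset.sum_nonneg fun e _ => hy e
  have mem_polytope_iff : ∀ z, intVec w +
      realCombination (Module.finBasis ℤ (integerPoints G.flowSpace)) z ∈
        G.flowPolytope (Pi.single 0 2) ↔ Fin.cons 1 z ∈ C := fun z => by
    rw [← one_smul ℝ (intVec w), ← realCombination_sinkBasis hw hw₁, mem_flowPolytope_iff,
      sinkFlow_realCombination_sinkBasis]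
    exact and_iff_left ⟨realCombination_mem_conservedFlows _ _, rfl⟩
  calc normalizedVolumeIn G.flowSpace (G.flowPolytope (Pi.single 0 2))
      = ((Module.finrank ℤ (integerPoints G.flowSpace))! : ℝ≥0∞) *
          volume {z | Fin.cons 1 z ∈ C} := by
        rw [normalizedVolumeIn_eq_of_basePoint _ fun p => exists_add_realCombination_eq hw hw₁ ht]
        simp only [mem_polytope_iff]
    _ = ∫⁻ y in C, ENNReal.ofReal (Real.exp (-y 0)) :=
        (setLIntegral_exp_cone measurableSet_C smul_mem sink_nonneg).symm
    _ = ∫⁻ y, flowDensity (G := G) 0 0 (realCombination b y) := by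
        rw [← lintegral_indicator measurableSet_C]
        refine lintegral_congr fun y => ?_
        rw [flowDensity_zero, sinkFlow_realCombination_sinkBasis, Set.indicator_apply]
        congr
    _ = ∫⁻ y, flowDensity (G := G) 0 0 (freeFlow ht y) := by
        simp only [lintegral_realCombination_eq b (freeBasis ht) (measurable_flowDensity 0 0),
          realCombination_freeBasis]

lemma vectorSpan_flowPolytope_le :
    vectorSpan ℝ (G.flowPolytope (Pi.single 0 2)) ≤ G.flowSpace := by
  rw [vectorSpan_def, Submodule.span_le]
  rintro _ ⟨p, hp, q, hq, rfl⟩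
  obtain ⟨-, p_conserved, p_sink⟩ := mem_flowPolytope_iff.1 hp
  obtain ⟨-, q_conserved, q_sink⟩ := mem_flowPolytope_iff.1 hq
  refine mem_flowSpace_iff.2 ⟨sub_mem p_conserved q_conserved, ?_⟩
  change G.sinkFlow ℝ (p - q) = 0
  rw [map_sub, p_sink, q_sink, sub_self]

lemma finrank_flowSpace_add_lt (ht : G.IsParentChoice t) {e : E} (he : G.sign e = 1) :
    Module.finrank ℝ G.flowSpace + n < Fintype.card E := by
  obtain ⟨w, hw, hw₁⟩ := exists_sinkFlow_eq_one ht he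
  have flowSpace_lt : G.flowSpace < G.conservedFlows ℝ := by
    refine SetLike.lt_iff_le_and_exists.2 ⟨fun f hf => (mem_flowSpace_iff.1 hf).1,
      intVec w, intVec_mem_conservedFlows.2 hw, fun hmem => ?_⟩
    have sink := (mem_flowSpace_iff.1 hmem).2
    rw [sinkFlow_intVec, hw₁, Int.cast_one] at sink
    exact one_ne_zero sink
  have := Submodule.finrank_lt_finrank_of_lt flowSpace_lt
  have := finrank_conservedFlows_add ht
  omega

end Volume

section NoPositiveEdge

variable {G : SignedGraph n E}

lemma flowPolytope_eq_empty (hneg : ∀ e, G.sign e ≠ 1) : G.flowPolytope (Pi.single 0 2) = ∅ := by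
  refine Set.eq_empty_of_forall_notMem fun f hf => zero_ne_one (α := ℝ) ?_
  rw [← (mem_flowPolytope_iff.1 hf).2.2, sinkFlow_apply, Finset.sum_eq_zero]
  exact fun e he => absurd (head_eq_succ_iff.1 (mem_inEdges.1 he)) (hneg e)

lemma card_eq_of_isPartialFlow (hneg : ∀ e, G.sign e ≠ 1) {b : G.HalfEdge → ℕ}
    (hb : IsPartialFlow n b) : Fintype.card E = n := by
  have : IsEmpty {e : E // G.sign e = 1} := ⟨fun e => hneg e e.2⟩
  have head_mem : ∀ e, G.head e ∈ Finset.Icc 1 n := fun e => by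
    have := G.head_pos e
    have := G.head_le e
    have := mt head_eq_succ_iff.1 (hneg e)
    exact Finset.mem_Icc.2 (by omega)
  have sum_in : ∑ v ∈ Finset.Icc 1 n, ∑ e ∈ G.inEdges v, (b (.inl e) + 1) =
      ∑ e, b (.inl e) + Fintype.card E := by
    simp only [inEdges]
    rw [Finset.sum_fiberwise_of_maps_to fun e _ => head_mem e, Finset.sum_add_distrib,
      Finset.sum_const, Finset.card_univ, smul_eq_mul, mul_one]
  have sum_out : ∑ v ∈ Finset.Icc 1 n, ∑ h ∈ G.outHalves v, b h = ∑ e, b (.inl e) := by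
    simp only [outHalves, Finset.sum_filter]
    rw [Finset.sum_comm]
    simp only [Finset.sum_ite_eq]
    rw [Fintype.sum_sum_type, Finset.univ_eq_empty (α := {e : E // G.sign e = 1}),
      Finset.sum_empty, add_zero]
    exact Finset.sum_congr rfl fun e _ => ite_eq_left_iff.2 fun he =>
      (of_not_not (mt (hb.1 (.inl e)) he)).symm
  have total := Finset.sum_congr rfl hb.2
  rw [sum_in, Finset.sum_add_distrib, sum_out, Finset.sum_const, Nat.card_Icc, smul_eq_mul,
    mul_one] at total
  omega

lemma partialFlows_eq_empty (hin : ∀ v ∈ Finset.Icc 1 n, (G.inEdges v).Nonempty)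
    (hneg : ∀ e, G.sign e ≠ 1) (hcard : n < Fintype.card E) : G.partialFlows n = ∅ :=
  Finset.eq_empty_of_forall_notMem fun _ hb =>
    hcard.ne' (card_eq_of_isPartialFlow hneg ((mem_partialFlows hin le_rfl).1 hb))

end NoPositiveEdge

section ParentChoice

variable (G : SignedGraph n E)

lemma inEdges_nonempty (hin : ∀ i : Fin (n + 1), i ≠ 0 → 1 ≤ G.indeg i) :
    ∀ v ∈ Finset.Icc 1 n, (G.inEdges v).Nonempty := fun v hv => by
  obtain ⟨hv1, hvn⟩ := Finset.mem_Icc.1 hv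
  have indeg_pos := hin ⟨v, by omega⟩ (Fin.val_ne_zero_iff.1 (by simp; omega))
  rwa [← card_inEdges, Nat.one_le_iff_ne_zero, Finset.card_ne_zero] at indeg_pos

lemma exists_isParentChoice [Nonempty E] (hin : ∀ v ∈ Finset.Icc 1 n, (G.inEdges v).Nonempty) :
    ∃ t, G.IsParentChoice t := by
  have exists_parent : ∀ v, ∃ e, v ∈ Finset.Icc 1 n → G.head e = v := fun v => by
    by_cases hv : v ∈ Finset.Icc 1 n
    · exact (hin v hv).imp fun e he _ => mem_inEdges.1 he
    · exact ⟨Classical.arbitrary E, fun h => absurd h hv⟩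
  choose t ht using exists_parent
  exact ⟨t, ht⟩

end ParentChoice

end SignedGraph

end

open SignedGraph in
theorem theorem6p4_general {n : ℕ} {E : Type*} [Fintype E] (G : SignedGraph n E)
    (hin : ∀ i : Fin (n + 1), i ≠ 0 → 1 ≤ G.indeg i)
    (hcard : n + 1 ≤ Fintype.card E) :
    normalizedVolumeIn G.flowSpace (G.flowPolytope (Pi.single 0 2)) =
        ((G.dynamicKostant G.shiftedIndeg : ℕ∞) : ℝ≥0∞) ∧
    (Module.finrank ℝ (vectorSpan ℝ (G.flowPolytope (Pi.single 0 2))) + (n + 1) =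
        Fintype.card E →
      normalizedVolume (G.flowPolytope (Pi.single 0 2)) =
        ((G.dynamicKostant G.shiftedIndeg : ℕ∞) : ℝ≥0∞)) := by
  have entering := G.inEdges_nonempty hin
  by_cases! hneg : ∀ e, G.sign e ≠ 1
  · rw [dynamicKostant_eq_sum entering, partialFlows_eq_empty entering hneg hcard,
      Finset.sum_empty, flowPolytope_eq_empty hneg]
    simp [normalizedVolume, normalizedVolumeIn]
  · obtain ⟨e, he⟩ := hneg
    have : Nonempty E := ⟨e⟩
    obtain ⟨t, ht⟩ := G.exists_isParentChoice entering
    obtain ⟨w, hw, hw₁⟩ := exists_sinkFlow_eq_one ht he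
    have volume_eq : normalizedVolumeIn G.flowSpace (G.flowPolytope (Pi.single 0 2)) =
        ((G.dynamicKostant G.shiftedIndeg : ℕ∞) : ℝ≥0∞) := by
      rw [normalizedVolumeIn_flowSpace hw hw₁ ht, lintegral_flowDensity_freeFlow,
        dynamicKostant_eq_sum entering]
    refine ⟨volume_eq, fun full_dim => ?_⟩
    have := finrank_flowSpace_add_lt ht he
    rw [normalizedVolume,
      Submodule.eq_of_le_of_finrank_le vectorSpan_flowPolytope_le (by omega), volume_eq]

theorem theorem6p4 {n : ℕ} {E : Type*} [Fintype E] (G : SignedGraph n E)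
    (hloop : G.Loopless) (hconn : G.Connected)
    (hin : ∀ i : Fin (n + 1), i ≠ 0 → 1 ≤ G.indeg i)
    (hcard : n + 1 ≤ Fintype.card E) :
    normalizedVolumeIn G.flowSpace (G.flowPolytope (Pi.single 0 2)) =
        ((G.dynamicKostant G.shiftedIndeg : ℕ∞) : ℝ≥0∞) ∧
    (Module.finrank ℝ (vectorSpan ℝ (G.flowPolytope (Pi.single 0 2))) + (n + 1) =
        Fintype.card E →
      normalizedVolume (G.flowPolytope (Pi.single 0 2)) =
        ((G.dynamicKostant G.shiftedIndeg : ℕ∞) : ℝ≥0∞)) :=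
  theorem6p4_general G hin hcard
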